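/- Let $n>1$, $\tau\in\mathbb C$ with $\operatorname{Im}\tau>0$, and $c,u\in\mathbb C$. Put $\theta_{m,l}(u,\tau)=\sum_{\mu\in m+l\mathbb Z}e^{2\pi i(\mu u+\mu^2\tau/(2l))}$, $\theta(u)=\theta_{1/2,1}(u+\tfrac12,\tau)$ and $\theta_j(u)=\theta_{n/2-j,\,n}(u+\tfrac12,\tau)$, and let $\eta$ be the Dedekind eta function. Let $\varepsilon_1,\dots,\varepsilon_n$ be the standard basis of $\mathbb C^n$, $\bar\varepsilon_i=\varepsilon_i-\frac1n\sum_j\varepsilon_j$, let $\langle\cdot,\cdot\rangle$ be the standard symmetric bilinear form, $\mathbf h^*=(\sum_j\varepsilon_j)^\perp$, and $\lambda_{i,j}=\langle\lambda,\bar\varepsilon_i-\bar\varepsilon_j\rangle$. Let either $W=\mathbf h^*$ and $v_i=\bar\varepsilon_i$, or $W=\mathbb C^n$ and $v_i=\varepsilon_i$. All operators act on functions $f$ on $W$; $\partial_i$ is the derivative in the direction $v_i$, $\partial^J=\prod_{i\in J}\partial_i$, and $\Delta(\lambda)=\prod_{i<j}\theta(\lambda_{i,j})$. Difference operators. Put $\phi(u,\lambda)_{jk}=\theta_j(\frac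 un-\langle\lambda,\bar\varepsilon_k\rangle)/(\sqrt{-1}\,\eta(\tau))$ for $1\le j,k\le n$, let $\bar\phi(u,\lambda)=\phi(u,\lambda)^{-1}$ be the inverse matrix, and for $\hbar\in\mathbb C$ $$(L(u)^i_jf)(\lambda)=\sum_{k=1}^n\phi(u+c\hbar,\lambda)_{jk}\,\bar\phi(u,\lambda)_{ki}\,f(\lambda+\hbar v_k).$$ Let $M_d$ be the trace of the antisymmetrically fused L-operator, $$M_d=\sum_{i_1<\dots<i_d}\ \sum_{\sigma\in S_d}\operatorname{sgn}(\sigma)\,L(u)^{i_{\sigma(1)}}_{i_1}L(u-\hbar)^{i_{\sigma(2)}}_{i_2}\cdots L(u-(d-1)\hbar)^{i_{\sigma(d)}}_{i_d}\quad(0\le d\le n,\ M_0=\mathrm{id}),$$ and $\dot M_d=\dfrac{\theta(u)}{\theta(u+\frac{cd}{n}\hbar)}M_d$. Differential operators. For $c\neq0$ and $0\le m\le n$ let $$D[m]=\sum_{|I|=m}\ \sum_{J\subset I}\frac{\partial^J\Delta}{\Delta}\Big(-\frac nc\Big)^{|I\setminus J|}\partial^{I\setminus J},$$ and let $H$ be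 the elliptic Calogero–Moser operator $$H=\Delta^{c/n}\circ\Big(\sum_{i=1}^n\partial_i^2+2\,\frac cn\Big(\frac cn+1\Big)\sum_{i<j}(\log\theta)''(\lambda_{i,j})\Big)\circ\Delta^{-c/n},$$ where the powers of $\Delta$ are formed with any local holomorphic branch of $\log\Delta$. Assume $\theta(u)\ne0$, let $\lambda\in W$ with $\theta(\lambda_{i,j})\neq0$ for all $i\ne j$, and let $f$ be a function on $W$ that is holomorphic near $\lambda$. Then $\hbar\mapsto(\dot M_{k'}f)(\lambda)$ is holomorphic near $\hbar=0$ for $0\le k'\le n$, and: (1) if $c\ne0$, then for all $0\le k\le d\le n$ $$(D[d-k]f)(\lambda)=\frac{(-\frac nc)^d}{\binom{n-d+k}{k}}\sum_{k'=0}^d(-1)^{d-k'}\binom{n-k'}{n-d}\frac{(-\frac{ck'}n)^k}{k!}\,\frac{1}{(d-k)!}\,\partial_\hbar^{\,d-k}(\dot M_{k'}f)(\lambda)\Big|_{\hbar=0};$$ (2) local holomorphic branches of $\log\Delta$ near $\lambda$ exist and, for each of them, $$\frac{1}{\hbar^2}\Big(\big(-2\dot M_2+\dot M_1^2-2\dot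 M_1+n\big)f\Big)(\lambda)\ \longrightarrow\ (Hf)(\lambda)\qquad(\hbar\to0,\ \hbar\neq0).$$ -/

import Mathlib

open Complex Filter Topology

noncomputable section

namespace EllipticCM

/-- `θ_{m,l}(u,τ) = ∑_{μ ∈ m + lℤ} exp 2πi (μ u + μ² τ / (2l))`. -/
def thetaChar (m l u τ : ℂ) : ℂ :=
  ∑' k : ℤ, cexp (2 * Real.pi * I * ((m + l * k) * u + (m + l * k) ^ 2 / (2 * l) * τ))

/-- The Jacobi theta function `θ(u) = θ_{1/2,1}(u + 1/2, τ)` (odd, with simple zeros on `ℤ + ℤτ`). -/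
def theta (τ u : ℂ) : ℂ := thetaChar (1 / 2) 1 (u + 1 / 2) τ

/-- `θ_j(u) = θ_{n/2-j,n}(u + 1/2, τ)`. -/
def thetaLevel (n : ℕ) (τ : ℂ) (j : ℕ) (u : ℂ) : ℂ := thetaChar ((n : ℂ) / 2 - (j : ℂ)) n (u + 1 / 2) τ

/-- The weight space `𝔥*` of `sl_n(ℂ)`: the orthogonal complement of `∑ ε_i` in `ℂⁿ`. -/
def weightSpace (n : ℕ) : Submodule ℂ (EuclideanSpace ℂ (Fin n)) :=
  (Submodule.span ℂ {∑ i : Fin n, EuclideanSpace.single i (1 : ℂ)})ᗮ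

variable {n : ℕ} (W : Submodule ℂ (EuclideanSpace ℂ (Fin n)))

/-- The orthogonal projection of `ε_i` to `W`: it is `ε̄_i` for `W = 𝔥*`, and `ε_i` for `W = ℂⁿ`. -/
def dir (i : Fin n) : W := W.orthogonalProjectionOnto (EuclideanSpace.single i (1 : ℂ))

/-- `⟨x, ε̄_k⟩`, where `ε̄_k = ε_k - (1/n) ∑ ε_i`. -/
def pairBar (x : W) (k : Fin n) : ℂ :=
  (x : EuclideanSpace ℂ (Fin n)) k - (∑ i, (x : EuclideanSpace ℂ (Fin n)) i) / n

/-- `x_{i,j} = ⟨x, ε̄_i - ε̄_j⟩`. -/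
def diffBar (x : W) (i j : Fin n) : ℂ := pairBar W x i - pairBar W x j

/-- The matrix of outgoing intertwining vectors: the entry in row `j` and column `k` is
`φ(u)^{x + ħ ε̄_k}_{x, j} = θ_j(u/n - ⟨x, ε̄_k⟩) / (√-1 η(τ))`, the labels `j = 1, …, n` being
represented by `Fin n`. -/
def outVec (τ u : ℂ) (x : W) : Matrix (Fin n) (Fin n) ℂ :=
  Matrix.of fun j k => thetaLevel n τ ((j : ℕ) + 1) (u / n - pairBar W x k) / (I * ModularForm.eta τ)

/-- The incoming intertwining vectors: the entry in row `k` and column `j` is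
`φ̄(u)^{x + ħ ε̄_k, j}_x`. -/
def inVec (τ u : ℂ) (x : W) : Matrix (Fin n) (Fin n) ℂ := (outVec W τ u x)⁻¹

/-- The matrix element `L(c|u)^i_j` of the factorized L-operator with step `h`. -/
def Lop (τ c h u : ℂ) (i j : Fin n) (f : W → ℂ) : W → ℂ := fun x =>
  ∑ k, outVec W τ (u + c * h) x j k * inVec W τ u x k i * f (x + h • dir W k)

/-- The matrix element `L(c|1^d_u)^I_{I'}` of the antisymmetrically fused L-operator, where
`I = {a 0 < ⋯ < a (d-1)}` and `I' = {b 0 < ⋯ < b (d-1)}`: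
`∑_σ sgn σ L(c|u)^{a (σ 0)}_{b 0} ∘ L(c|u-h)^{a (σ 1)}_{b 1} ∘ ⋯ ∘ L(c|u-(d-1)h)^{a (σ (d-1))}_{b (d-1)}`. -/
def fusedL (τ c h u : ℂ) {d : ℕ} (a b : Fin d → Fin n) (f : W → ℂ) : W → ℂ := fun x =>
  ∑ σ : Equiv.Perm (Fin d), ((Equiv.Perm.sign σ : ℤ) : ℂ) *
    (List.finRange d).foldr (fun (r : Fin d) g => Lop W τ c h (u - ((r : ℕ) : ℂ) * h) (a (σ r)) (b r) g) f x

/-- `M_d(c|u)`, the trace of the fused L-operator; `M_0 = id`. -/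
def M (τ c h u : ℂ) (d : ℕ) (f : W → ℂ) : W → ℂ := fun x =>
  ∑ S : {S : Finset (Fin n) // S.card = d},
    fusedL W τ c h u (S.1.orderEmbOfFin S.2) (S.1.orderEmbOfFin S.2) f x

/-- `Ṁ_d = θ(u) / θ(u + c d h / n) M_d(c|u)`. -/
def Mdot (τ c h u : ℂ) (d : ℕ) (f : W → ℂ) : W → ℂ := fun x =>
  theta τ u / theta τ (u + c * d / n * h) * M W τ c h u d f x

/-- `∂_i`, the derivative in the direction `dir W i`. -/
def pd (i : Fin n) (f : W → ℂ) : W → ℂ := fun x => lineDeriv ℂ f x (dir W i)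

/-- `∂^S = ∏_{i ∈ S} ∂_i`. -/
def pdSet (S : Finset (Fin n)) (f : W → ℂ) : W → ℂ := S.sort.foldr (fun i g => pd W i g) f

/-- `Δ(x) = ∏_{i<j} θ(x_{i,j})`. -/
def Delta (τ : ℂ) : W → ℂ := fun x =>
  ∏ i : Fin n, ∏ j ∈ Finset.Ioi i, theta τ (diffBar W x i j)

/-- `D[m] = ∑_{|S|=m} ∑_{J ⊆ S} (∂^J Δ / Δ) (-(n/c) ∂)^{S \ J}`. -/
def Dop (τ c : ℂ) (m : ℕ) (f : W → ℂ) : W → ℂ := fun x =>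
  ∑ S ∈ Finset.powersetCard m (Finset.univ : Finset (Fin n)), ∑ J ∈ S.powerset,
    pdSet W J (Delta W τ) x / Delta W τ x * ((-(n / c)) ^ (S \ J).card * pdSet W (S \ J) f x)

/-- `l` is a holomorphic branch of `log Δ` near `x`. -/
def IsLogDelta (τ : ℂ) (l : W → ℂ) (x : W) : Prop :=
  AnalyticAt ℂ l x ∧ ∀ᶠ y in 𝓝 x, cexp (l y) = Delta W τ y

/-- The elliptic Calogero–Moser operator
`Δ^{g} ∘ (∑ ∂_i² + 2 g (g + 1) ∑_{i<j} (log θ)''(x_{i,j})) ∘ Δ^{-g}`, `g = c/n`,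
the powers of `Δ` being taken with the branch `l` of `log Δ`. -/
def Hop (τ c : ℂ) (l : W → ℂ) (f : W → ℂ) : W → ℂ := fun x =>
  let F : W → ℂ := fun y => cexp (-(c / n) * l y) * f y
  cexp (c / n * l x) *
    (∑ i, pd W i (pd W i F) x +
      2 * (c / n) * (c / n + 1) *
        (∑ i : Fin n, ∑ j ∈ Finset.Ioi i, deriv (logDeriv (theta τ)) (diffBar W x i j)) * F x)

end EllipticCM

end

/-!
Both claims rest on one formula. The outgoing intertwining vectors form a matrix of values of a
basis of a space of theta functions of order `n`; by quasi-periodicity its determinant is a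
constant times `θ(∑ wₖ) ∏_{i<j} θ(wⱼ - wᵢ)`, the elliptic analogue of the Vandermonde determinant.
Expanding the trace of the fused L-operator by the Cauchy–Binet formula therefore gives, with
`g = c/n` and `v_K = ∑_{i ∈ K} vᵢ`,
`(Ṁ_d f)(x) = ∑_{|K| = d} Δ(x - g ħ v_K) / Δ(x) * f(x + ħ v_K)`.

(1) Up to the factor `1 / Δ(x)`, the `m`-th derivative of this sum at `ħ = 0` is the sum over `K`
of the symmetric `m`-linear form `D^m(Δ ⊗ f)` on the diagonal at `∑_{i ∈ K} (-g vᵢ, vᵢ)`. An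
alternating binomial sum over `d` isolates from these the part of the form that is multilinear in
distinct vectors, which is `D[m]`.

(2) With `Δ = exp l`, each summand is an exponential of differences of `l` times a shift of `f`. To
second order in `ħ` the diagonal terms of `Ṁ₁² - 2 Ṁ₁ + n` give `(∂ᵢ - g ∂ᵢl)²`, and the terms
`i ≠ j`, compared with `2 Ṁ₂`, give multiples of `∂ᵢ∂ⱼ l`, whose sum `-2 ∑_{i<j} (log θ)''` is the
source of the potential.
-/

noncomputable section

namespace EllipticCM

/-! ### Theta functions with characteristics -/

section ThetaFunctions

variable {n : ℕ} {τ : ℂ}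

lemma thetaChar_eq_jacobiTheta₂ (m : ℂ) {l : ℂ} (hl : l ≠ 0) (u τ : ℂ) :
    thetaChar m l u τ =
      cexp (2 * Real.pi * I * (m * u + m ^ 2 / (2 * l) * τ)) *
        jacobiTheta₂ (l * u + m * τ) (l * τ) := by
  rw [thetaChar, jacobiTheta₂, ← tsum_mul_left]
  congr 1; ext k
  rw [jacobiTheta₂_term, ← Complex.exp_add]
  congr 1
  field_simp
  ring

lemma natCast_mul_im_pos (n : ℕ) [NeZero n] (hτ : 0 < τ.im) : 0 < ((n : ℂ) * τ).im := by
  have hn : (0 : ℝ) < n := by exact_mod_cast NeZero.pos n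
  simpa using mul_pos hn hτ

lemma differentiable_thetaChar (m : ℂ) [NeZero n] (hτ : 0 < τ.im) :
    Differentiable ℂ fun u => thetaChar m n u τ := by
  simp_rw [thetaChar_eq_jacobiTheta₂ m (NeZero.ne (n : ℂ))]
  intro u
  exact DifferentiableAt.mul (by fun_prop)
    ((differentiableAt_jacobiTheta₂_fst _ (natCast_mul_im_pos n hτ)).comp u
      (f := fun u => (n : ℂ) * u + m * τ) (by fun_prop))

lemma differentiable_thetaLevel [NeZero n] (hτ : 0 < τ.im) (j : ℕ) :
    Differentiable ℂ (thetaLevel n τ j) :=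
  (differentiable_thetaChar _ hτ).comp (by fun_prop : Differentiable ℂ (· + _))

lemma cexp_nat_mul_pi_mul_I (n : ℕ) : cexp (n * (Real.pi * I)) = (-1) ^ n := by
  rw [Complex.exp_nat_mul, Complex.exp_pi_mul_I]

lemma thetaLevel_add_one (n : ℕ) (τ : ℂ) (j : ℕ) (u : ℂ) :
    thetaLevel n τ j (u + 1) = (-1) ^ n * thetaLevel n τ j u := by
  rw [thetaLevel, thetaLevel, thetaChar, thetaChar, ← tsum_mul_left]
  congr 1; ext k
  rw [← cexp_nat_mul_pi_mul_I, ← Complex.exp_add, Complex.exp_eq_exp_iff_exists_int]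
  exact ⟨n * k - j, by push_cast; ring⟩

lemma thetaLevel_add_inv (n : ℕ) [NeZero n] (τ : ℂ) (j : ℕ) (u : ℂ) :
    thetaLevel n τ j (u + 1 / n) =
      cexp (2 * Real.pi * I * (1 / 2 - j / n)) * thetaLevel n τ j u := by
  have hn : (n : ℂ) ≠ 0 := NeZero.ne _
  rw [thetaLevel, thetaLevel, thetaChar, thetaChar, ← tsum_mul_left]
  congr 1; ext k
  rw [← Complex.exp_add, Complex.exp_eq_exp_iff_exists_int]
  exact ⟨k, by field_simp; ring⟩

lemma thetaLevel_add_tau (n : ℕ) [NeZero n] (τ : ℂ) (j : ℕ) (u : ℂ) :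
    thetaLevel n τ j (u + τ) =
      (-1) ^ n * cexp (-(2 * Real.pi * I * (n * u + n * τ / 2))) * thetaLevel n τ j u := by
  have hn : (n : ℂ) ≠ 0 := NeZero.ne _
  rw [thetaLevel, thetaLevel, thetaChar, thetaChar, ← tsum_mul_left,
    ← (Equiv.addRight (1 : ℤ)).tsum_eq (fun k : ℤ => (-1) ^ n *
      cexp (-(2 * Real.pi * I * (n * u + n * τ / 2))) * _)]
  congr 1; ext k
  rw [← cexp_nat_mul_pi_mul_I, ← Complex.exp_add, ← Complex.exp_add,
    Complex.exp_eq_exp_iff_exists_int]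
  refine ⟨-n, ?_⟩
  simp only [Equiv.coe_addRight]
  push_cast
  field_simp
  ring

lemma theta_eq_thetaLevel (τ : ℂ) : theta τ = thetaLevel 1 τ 0 := by
  ext u; simp [theta, thetaLevel]

lemma differentiable_theta (hτ : 0 < τ.im) : Differentiable ℂ (theta τ) :=
  theta_eq_thetaLevel τ ▸ differentiable_thetaLevel hτ 0

lemma theta_neg (τ u : ℂ) : theta τ (-u) = -theta τ u := by
  rw [theta, theta, thetaChar, thetaChar, ← tsum_neg,
    ← (Equiv.neg ℤ).tsum_eq, ← (Equiv.addRight (1 : ℤ)).tsum_eq]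
  congr 1; ext k
  rw [← neg_one_mul (cexp _), ← Complex.exp_pi_mul_I, ← Complex.exp_add,
    Complex.exp_eq_exp_iff_exists_int]
  refine ⟨-(k + 1), ?_⟩
  simp only [Equiv.coe_addRight, Equiv.neg_apply]
  push_cast
  ring

lemma theta_zero (τ : ℂ) : theta τ 0 = 0 :=
  self_eq_neg.mp (by simpa using theta_neg τ 0)

lemma integral_cexp_int_mul (m : ℤ) :
    ∫ t in (0 : ℝ)..1, cexp (2 * Real.pi * I * m * t) = if m = 0 then 1 else 0 := by
  split_ifs with h
  · simp [h]
  · have h' : 2 * Real.pi * I * (m : ℂ) ≠ 0 := by simp [Real.pi_ne_zero, h]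
    have hexp : cexp (2 * Real.pi * I * m) = 1 :=
      Complex.exp_eq_one_iff.mpr ⟨m, by ring⟩
    simp [integral_exp_mul_complex h', hexp]

lemma integral_jacobiTheta₂ (hτ : 0 < τ.im) :
    ∫ t in (0 : ℝ)..1, jacobiTheta₂ t τ = 1 := by
  have hterm (k : ℤ) :
      ∫ t in (0 : ℝ)..1, jacobiTheta₂_term k t τ = if k = 0 then 1 else 0 := by
    simp_rw [jacobiTheta₂_term, Complex.exp_add]
    rw [intervalIntegral.integral_mul_const, integral_cexp_int_mul]
    split_ifs with h <;> simp [h]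
  have hsum : HasSum (fun k : ℤ => ∫ t in (0 : ℝ)..1, jacobiTheta₂_term k t τ)
      (∫ t in (0 : ℝ)..1, jacobiTheta₂ t τ) := by
    refine intervalIntegral.hasSum_integral_of_dominated_convergence
      (fun k _ => Real.exp (-Real.pi * (τ.im * k ^ 2 - 2 * 0 * |k|))) (fun k => ?_)
      (fun k => ?_) ?_ (by simp) ?_
    · exact Continuous.aestronglyMeasurable (by unfold jacobiTheta₂_term; fun_prop)
    · exact .of_forall fun t _ => norm_jacobiTheta₂_term_le hτ (by simp) le_rfl k
    · refine .of_forall fun t _ => ?_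
      simpa using summable_pow_mul_jacobiTheta₂_term_bound 0 hτ 0
    · exact .of_forall fun t _ => hasSum_jacobiTheta₂_term _ hτ
  simp_rw [hterm] at hsum
  exact hsum.unique (hasSum_ite_eq 0 1)

lemma exists_thetaLevel_ne_zero (n : ℕ) [NeZero n] (hτ : 0 < τ.im) (j : ℕ) :
    ∃ u, thetaLevel n τ j u ≠ 0 := by
  have hn : (n : ℂ) ≠ 0 := NeZero.ne _
  by_contra! h
  have hzero : ∀ z, jacobiTheta₂ z (n * τ) = 0 := by
    intro z
    have hz := h ((z - ((n : ℂ) / 2 - j) * τ) / n - 1 / 2)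
    rw [thetaLevel, thetaChar_eq_jacobiTheta₂ _ hn, mul_eq_zero] at hz
    convert hz.resolve_left (Complex.exp_ne_zero _) using 2
    field_simp
    ring
  simpa [hzero] using integral_jacobiTheta₂ (natCast_mul_im_pos n hτ)

lemma linearIndependent_thetaLevel [NeZero n] (hτ : 0 < τ.im) :
    LinearIndependent ℂ fun j : Fin n => thetaLevel n τ ((j : ℕ) + 1) := by
  have hn : (n : ℂ) ≠ 0 := NeZero.ne _
  -- The functions are eigenvectors of the translation by `1 / n` with distinct eigenvalues.
  let T : Module.End ℂ (ℂ → ℂ) := LinearMap.funLeft ℂ ℂ (fun z => z + 1 / (n : ℂ))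
  refine Module.End.eigenvectors_linearIndependent' T
    (fun j : Fin n => cexp (2 * Real.pi * I * (1 / 2 - ((j : ℕ) + 1 : ℕ) / n))) ?_ _ ?_
  · intro i j hij
    obtain ⟨m, hm⟩ := Complex.exp_eq_exp_iff_exists_int.mp hij
    have hdiff : ((j : ℕ) : ℤ) = (i : ℕ) + n * m := by
      have hm' : (1 / 2 - (((i : ℕ) + 1 : ℕ) : ℂ) / n) = 1 / 2 - (((j : ℕ) + 1 : ℕ) : ℂ) / n + m :=
        mul_left_cancel₀ two_pi_I_ne_zero (by rw [hm]; ring)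
      field_simp at hm'
      have : (((j : ℕ) : ℤ) : ℂ) = (((i : ℕ) + n * m : ℤ) : ℂ) := by
        push_cast at hm' ⊢
        linear_combination hm' / 2
      exact_mod_cast this
    have hmod : ((j : ℕ) : ℤ) % n = ((i : ℕ) : ℤ) % n := by rw [hdiff]; simp
    rw [Int.emod_eq_of_lt (by omega) (by omega), Int.emod_eq_of_lt (by omega) (by omega)] at hmod
    ext; omega
  · intro j
    rw [Module.End.hasEigenvector_iff, Module.End.mem_eigenspace_iff]
    obtain ⟨z, hz⟩ := exists_thetaLevel_ne_zero n hτ ((j : ℕ) + 1)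
    exact ⟨funext (thetaLevel_add_inv n τ _), fun h => hz (congrFun h z)⟩

end ThetaFunctions

/-! ### Spaces of theta functions -/

section ThetaSpace

variable {τ a b : ℂ} {N N' : ℕ} {f g : ℂ → ℂ}

/-- The theta functions of level `N` and characteristic `a`: the entire functions with the
multipliers of `∏ θ(z + b i)`, for `N` factors with `∑ b i = a`, under translation by `1` and `τ`.
-/
def thetaSpace (τ : ℂ) (N : ℕ) (a : ℂ) : Submodule ℂ (ℂ → ℂ) where
  carrier := {g | Differentiable ℂ g ∧ (∀ z, g (z + 1) = (-1) ^ N * g z) ∧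
    ∀ z, g (z + τ) = (-1) ^ N * cexp (-(2 * Real.pi * I * (N * z + a + N * τ / 2))) * g z}
  add_mem' := by
    rintro f g ⟨hf, hf1, hfτ⟩ ⟨hg, hg1, hgτ⟩
    refine ⟨hf.add hg, fun z => ?_, fun z => ?_⟩
    · simp only [Pi.add_apply, hf1, hg1, mul_add]
    · simp only [Pi.add_apply, hfτ, hgτ, mul_add]
  zero_mem' := ⟨differentiable_const 0, by simp, by simp⟩
  smul_mem' := by
    rintro r f ⟨hf, hf1, hfτ⟩
    refine ⟨hf.const_smul r, fun z => ?_, fun z => ?_⟩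
    · simp only [Pi.smul_apply, smul_eq_mul, hf1, mul_left_comm]
    · simp only [Pi.smul_apply, smul_eq_mul, hfτ, mul_left_comm]

lemma const_mem_thetaSpace (τ b : ℂ) : (fun _ => b) ∈ thetaSpace τ 0 0 :=
  ⟨differentiable_const b, by simp, by simp⟩

lemma mul_mem_thetaSpace (hf : f ∈ thetaSpace τ N a) (hg : g ∈ thetaSpace τ N' b) :
    (fun z => f z * g z) ∈ thetaSpace τ (N + N') (a + b) := by
  obtain ⟨hf, hf1, hfτ⟩ := hf
  obtain ⟨hg, hg1, hgτ⟩ := hg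
  refine ⟨hf.mul hg, fun z => ?_, fun z => ?_⟩
  · beta_reduce; rw [hf1, hg1]; ring
  · have hexp : cexp (-(2 * Real.pi * I * ((N + N' : ℕ) * z + (a + b) + (N + N' : ℕ) * τ / 2))) =
        cexp (-(2 * Real.pi * I * (N * z + a + N * τ / 2))) *
          cexp (-(2 * Real.pi * I * (N' * z + b + N' * τ / 2))) := by
      rw [← Complex.exp_add]; congr 1; push_cast; ring
    beta_reduce; rw [hfτ, hgτ, hexp]; ring

lemma prod_mem_thetaSpace {ι : Type*} {s : Finset ι} {N : ι → ℕ} {a : ι → ℂ} {f : ι → ℂ → ℂ}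
    (hf : ∀ i ∈ s, f i ∈ thetaSpace τ (N i) (a i)) :
    (fun z => ∏ i ∈ s, f i z) ∈ thetaSpace τ (∑ i ∈ s, N i) (∑ i ∈ s, a i) := by
  classical
  induction s using Finset.induction_on with
  | empty => simpa using const_mem_thetaSpace τ 1
  | insert i s hi ih =>
    simp only [Finset.sum_insert hi, Finset.prod_insert hi]
    exact mul_mem_thetaSpace (hf i (Finset.mem_insert_self i s))
      (ih fun j hj => hf j (Finset.mem_insert_of_mem hj))

lemma thetaLevel_mem_thetaSpace [NeZero N] (hτ : 0 < τ.im) (j : ℕ) :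
    thetaLevel N τ j ∈ thetaSpace τ N 0 :=
  ⟨differentiable_thetaLevel hτ j, thetaLevel_add_one N τ j,
    fun z => by rw [thetaLevel_add_tau, add_zero]⟩

lemma theta_add_mem_thetaSpace (hτ : 0 < τ.im) (b : ℂ) :
    (fun z => theta τ (z + b)) ∈ thetaSpace τ 1 b := by
  refine ⟨(differentiable_theta hτ).comp (by fun_prop : Differentiable ℂ (· + b)),
    fun z => ?_, fun z => ?_⟩
  · beta_reduce
    rw [add_right_comm, theta_eq_thetaLevel, thetaLevel_add_one]
  · beta_reduce
    rw [add_right_comm z, theta_eq_thetaLevel, thetaLevel_add_tau]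
    congr 3
    push_cast
    ring

lemma theta_sub_mem_thetaSpace (hτ : 0 < τ.im) (b : ℂ) :
    (fun z => theta τ (b - z)) ∈ thetaSpace τ 1 (-b) := by
  convert (thetaSpace τ 1 (-b)).neg_mem (theta_add_mem_thetaSpace hτ (-b)) using 1
  ext z
  rw [Pi.neg_apply, ← theta_neg, neg_add, neg_neg, neg_add_eq_sub]

lemma integral_add_eq_of_forall_add_one {F : ℂ → ℂ} (hF : Differentiable ℂ F)
    (hp : ∀ z, F (z + 1) = F z) (w : ℂ) :
    ∫ t in (0 : ℝ)..1, F (t + w) = ∫ t in (0 : ℝ)..1, F t := by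
  have hreal : ∫ t in (0 : ℝ)..1, F (t + w) = ∫ t in (0 : ℝ)..1, F (t + w.im * I) := by
    have hper : Function.Periodic (fun t : ℝ => F (t + w.im * I)) 1 := fun t => by
      simpa [add_right_comm] using hp (t + w.im * I)
    rw [← zero_add (1 : ℝ), ← hper.intervalIntegral_add_eq w.re 0, add_comm w.re 1,
      ← zero_add w.re, ← add_assoc, zero_add, add_zero,
      ← intervalIntegral.integral_comp_add_right (fun t : ℝ => F (t + w.im * I)) w.re]
    congr 1; ext t
    rw [Complex.ofReal_add, add_assoc, Complex.re_add_im]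
  have hvert : ∀ y : ℝ, F (1 + y * I) = F (y * I) := fun y => by rw [add_comm, hp]
  have hrect := Complex.integral_boundary_rect_eq_zero_of_differentiableOn F 0 (1 + w.im * I)
    hF.differentiableOn
  simp only [zero_im, ofReal_zero, zero_mul, add_zero, zero_re, add_re, one_re, mul_re, ofReal_re,
    I_re, mul_zero, ofReal_im, I_im, mul_one, sub_self, add_im, one_im, mul_im, zero_add,
    ofReal_one, hvert, smul_eq_mul, add_sub_cancel_right] at hrect
  rw [hreal]
  linear_combination -hrect

lemma eq_zero_of_forall_ofReal_eq_zero (hg : Differentiable ℂ g) (h : ∀ t : ℝ, g t = 0) :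
    g = 0 := by
  have han : AnalyticOnNhd ℂ g Set.univ := fun z _ => hg.analyticAt z
  have hlim : Tendsto (fun t : ℝ => (t : ℂ)) (𝓝[≠] 0) (𝓝[≠] 0) :=
    tendsto_nhdsWithin_iff.mpr
      ⟨(Complex.continuous_ofReal.tendsto' 0 0 Complex.ofReal_zero).mono_left nhdsWithin_le_nhds,
      eventually_mem_nhdsWithin.mono fun t ht => by simpa using ht⟩
  ext z
  exact han.eqOn_zero_of_preconnected_of_frequently_eq_zero isPreconnected_univ
    (Set.mem_univ 0) (hlim.frequently (Frequently.of_forall h)) (Set.mem_univ z)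

lemma eq_zero_of_integral_mul_cexp_eq_zero {F : ℝ → ℂ} (hF : Continuous F)
    (hp : Function.Periodic F 1)
    (h : ∀ m : ℤ, ∫ t in (0 : ℝ)..1, F t * cexp (-(2 * Real.pi * I * m * t)) = 0) : F = 0 := by
  have : Fact ((0 : ℝ) < 1) := ⟨one_pos⟩
  let G : C(AddCircle (1 : ℝ), ℂ) := ⟨hp.lift, continuous_coinduced_dom.mpr hF⟩
  have hcoeff (m : ℤ) : fourierCoeff G m = 0 := by
    rw [fourierCoeff_eq_intervalIntegral G m 0, zero_add, ← h m, one_div, inv_one, one_smul]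
    congr 1; ext t
    rw [show G t = F t from hp.lift_coe t, fourier_coe_apply, smul_eq_mul, mul_comm]
    push_cast
    ring_nf
  have hseries := hasSum_fourier_series_of_summable (f := G) (by
    rw [show fourierCoeff G = fun _ => 0 from funext hcoeff]; exact summable_zero)
  simp only [hcoeff, zero_smul] at hseries
  ext t
  rw [← hp.lift_coe t]
  exact DFunLike.congr_fun (hseries.unique hasSum_zero) (t : AddCircle (1 : ℝ))

/-- The Fourier coefficient of `g` at the frequency `N / 2 + m`; for `g` of level `N` these are all
the frequencies that occur. -/
def thetaCoeff (N : ℕ) (m : ℤ) (g : ℂ → ℂ) : ℂ :=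
  ∫ t in (0 : ℝ)..1, g t * cexp (-(2 * Real.pi * I * (N / 2 + m) * t))

lemma exists_thetaCoeff_eq_mul (hg : g ∈ thetaSpace τ N a) (m : ℤ) :
    ∃ q : ℂ, q ≠ 0 ∧ thetaCoeff N m g = q * thetaCoeff N (m + N) g := by
  obtain ⟨hd, h1, hτ⟩ := hg
  refine ⟨(-1) ^ N * cexp (-(2 * Real.pi * I * (a + N * τ / 2 + (N / 2 + m) * τ))), by simp, ?_⟩
  have hper (z : ℂ) : g (z + 1) * cexp (-(2 * Real.pi * I * (N / 2 + m) * (z + 1))) =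
      g z * cexp (-(2 * Real.pi * I * (N / 2 + m) * z)) := by
    rw [h1, ← cexp_nat_mul_pi_mul_I, mul_right_comm, ← Complex.exp_add, mul_comm]
    congr 1
    rw [Complex.exp_eq_exp_iff_exists_int]
    exact ⟨-m, by push_cast; ring⟩
  rw [thetaCoeff, thetaCoeff, ← integral_add_eq_of_forall_add_one
    (F := fun z => g z * cexp (-(2 * Real.pi * I * (N / 2 + m) * z))) (by fun_prop) hper τ,
    ← intervalIntegral.integral_const_mul]
  congr 1; ext t
  have hexp : cexp (-(2 * Real.pi * I * (N * t + a + N * τ / 2))) *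
        cexp (-(2 * Real.pi * I * (N / 2 + m) * (t + τ))) =
      cexp (-(2 * Real.pi * I * (a + N * τ / 2 + (N / 2 + m) * τ))) *
        cexp (-(2 * Real.pi * I * (N / 2 + (m + N : ℤ)) * t)) := by
    rw [← Complex.exp_add, ← Complex.exp_add]
    congr 1
    push_cast
    ring
  rw [hτ]
  linear_combination (-1) ^ N * g t * hexp

lemma eq_zero_of_thetaCoeff_eq_zero (hg : g ∈ thetaSpace τ N a)
    (h : ∀ m, thetaCoeff N m g = 0) : g = 0 := by
  obtain ⟨hd, h1, -⟩ := hg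
  have hc := hd.continuous
  refine eq_zero_of_forall_ofReal_eq_zero hd fun t => ?_
  have hF := eq_zero_of_integral_mul_cexp_eq_zero
    (F := fun t => g t * cexp (-(Real.pi * I * N * t))) (by fun_prop) (fun t => ?_) (fun m => ?_)
  · exact (mul_eq_zero.mp (congrFun hF t)).resolve_right (Complex.exp_ne_zero _)
  · push_cast
    rw [h1, ← cexp_nat_mul_pi_mul_I, mul_right_comm, ← Complex.exp_add, mul_comm]
    ring_nf
  · rw [← h m, thetaCoeff]
    congr 1; ext t
    rw [mul_assoc, ← Complex.exp_add]
    ring_nf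

lemma thetaCoeff_add_mul_eq_zero_iff (hg : g ∈ thetaSpace τ N a) (m q : ℤ) :
    thetaCoeff N (m + q * N) g = 0 ↔ thetaCoeff N m g = 0 := by
  have hstep (m : ℤ) : thetaCoeff N (m + N) g = 0 ↔ thetaCoeff N m g = 0 := by
    obtain ⟨r, hr, hm⟩ := exists_thetaCoeff_eq_mul hg m
    rw [hm, mul_eq_zero, or_iff_right hr]
  induction q using Int.induction_on with
  | zero => simp
  | succ q ih => rwa [add_mul, one_mul, ← add_assoc, hstep]
  | pred q ih => rwa [← hstep, add_assoc, ← add_one_mul, sub_add_cancel]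

/-- The `N` consecutive Fourier coefficients that determine a theta function of level `N`. -/
def thetaCoeffs (τ : ℂ) (N : ℕ) (a : ℂ) : thetaSpace τ N a →ₗ[ℂ] (Fin N → ℂ) where
  toFun g m := thetaCoeff N (m : ℕ) g
  map_add' f g := by
    have hf := f.2.1.continuous
    have hg := g.2.1.continuous
    ext m
    simp only [thetaCoeff, Submodule.coe_add, Pi.add_apply, add_mul]
    exact intervalIntegral.integral_add (Continuous.intervalIntegrable (by fun_prop) _ _)
      (Continuous.intervalIntegrable (by fun_prop) _ _)
  map_smul' r f := by
    ext m
    simp only [thetaCoeff, Submodule.coe_smul, Pi.smul_apply, smul_eq_mul, mul_assoc,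
      intervalIntegral.integral_const_mul, RingHom.id_apply]

lemma thetaCoeffs_injective (τ : ℂ) (N : ℕ) [NeZero N] (a : ℂ) :
    Function.Injective (thetaCoeffs τ N a) := by
  rw [← LinearMap.ker_eq_bot, LinearMap.ker_eq_bot']
  intro g hg
  refine Subtype.ext (eq_zero_of_thetaCoeff_eq_zero g.2 fun m => ?_)
  have hN : (0 : ℤ) < N := by exact_mod_cast NeZero.pos N
  have hnonneg := Int.emod_nonneg m hN.ne'
  have hlt := Int.emod_lt_of_pos m hN
  rw [← Int.emod_add_mul_ediv m N, mul_comm (N : ℤ), thetaCoeff_add_mul_eq_zero_iff g.2]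
  simpa [thetaCoeffs, Int.toNat_of_nonneg hnonneg] using
    congrFun hg ⟨(m % N).toNat, by omega⟩

end ThetaSpace

/-! ### The determinant of theta functions -/

section ThetaDet

variable {n : ℕ} {τ : ℂ}

/-- The elliptic Vandermonde product `θ(∑ z_i) ∏_{i<j} θ(z_j - z_i)`. -/
def thetaVandermonde (τ : ℂ) (z : Fin n → ℂ) : ℂ :=
  theta τ (∑ i, z i) * ∏ i : Fin n, ∏ j ∈ Finset.Ioi i, theta τ (z j - z i)

lemma sum_sum_Ioi_ite_add {M : Type*} [AddCommMonoid M] (l : Fin n) (f : Fin n → M) :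
    ∑ i, ∑ j ∈ Finset.Ioi i, ((if i = l then f j else 0) + if j = l then f i else 0) =
      ∑ i ∈ Finset.univ.erase l, f i := by
  have hgt : ∑ i, ∑ j ∈ Finset.Ioi i, (if i = l then f j else 0) = ∑ j ∈ Finset.Ioi l, f j := by
    rw [Finset.sum_eq_single l (fun i _ hi => by simp [hi]) (by simp)]
    simp
  have hlt : ∑ i, ∑ j ∈ Finset.Ioi i, (if j = l then f i else 0) = ∑ i ∈ Finset.Iio l, f i := by
    simp only [Finset.sum_ite_eq', Finset.mem_Ioi, ← Finset.sum_filter]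
    congr 1; ext i; simp
  have hunion : Finset.univ.erase l = Finset.Ioi l ∪ Finset.Iio l := by
    ext i; simp [eq_comm, ← lt_or_lt_iff_ne]
  rw [hunion, Finset.sum_union (Finset.disjoint_left.mpr fun i hi hi' =>
    lt_asymm (Finset.mem_Ioi.mp hi) (Finset.mem_Iio.mp hi')), ← hgt, ← hlt]
  simp only [Finset.sum_add_distrib]

lemma theta_sub_update_mem_thetaSpace (hτ : 0 < τ.im) (w : Fin n → ℂ) (l : Fin n) {i j : Fin n}
    (hij : i ≠ j) :
    (fun y => theta τ (Function.update w l y j - Function.update w l y i)) ∈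
      thetaSpace τ ((if i = l then 1 else 0) + if j = l then 1 else 0)
        ((if i = l then -w j else 0) + if j = l then -w i else 0) := by
  rcases eq_or_ne i l with rfl | hi
  · simpa [hij.symm] using theta_sub_mem_thetaSpace hτ (w j)
  · rcases eq_or_ne j l with rfl | hj
    · simpa [hi, sub_eq_add_neg] using theta_add_mem_thetaSpace hτ (-w i)
    · simpa [hi, hj] using const_mem_thetaSpace τ _

lemma thetaVandermonde_update_mem_thetaSpace (hτ : 0 < τ.im) (w : Fin n → ℂ) (l : Fin n) :
    (fun y => thetaVandermonde τ (Function.update w l y)) ∈ thetaSpace τ n 0 := by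
  have hprod := prod_mem_thetaSpace (s := Finset.univ) fun i _ =>
    prod_mem_thetaSpace (s := Finset.Ioi i) fun j hj =>
      theta_sub_update_mem_thetaSpace hτ w l (Finset.mem_Ioi.mp hj).ne
  rw [sum_sum_Ioi_ite_add l fun _ => 1, sum_sum_Ioi_ite_add l fun i => -w i] at hprod
  have hsum : (fun y => theta τ (∑ i, Function.update w l y i)) ∈
      thetaSpace τ 1 (∑ i ∈ Finset.univ.erase l, w i) := by
    convert theta_add_mem_thetaSpace hτ (∑ i ∈ Finset.univ.erase l, w i) using 3 with y
    rw [Finset.sum_update_of_mem (Finset.mem_univ l), Finset.sdiff_singleton_eq_erase]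
  have hcard : 1 + ∑ i ∈ Finset.univ.erase l, 1 = n := by
    rw [Finset.add_sum_erase _ (fun _ => 1) (Finset.mem_univ l), Fin.sum_const, smul_eq_mul,
      mul_one]
  have hmem := mul_mem_thetaSpace hsum hprod
  rwa [hcard, Finset.sum_neg_distrib, add_neg_cancel] at hmem

lemma thetaVandermonde_eq_zero_of_eq (τ : ℂ) {z : Fin n → ℂ} {i j : Fin n} (hij : i ≠ j)
    (h : z i = z j) : thetaVandermonde τ z = 0 := by
  wlog hlt : i < j generalizing i j
  · exact this hij.symm h.symm (lt_of_le_of_ne (not_lt.mp hlt) hij.symm)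
  refine mul_eq_zero_of_right _ (Finset.prod_eq_zero (Finset.mem_univ i)
    (Finset.prod_eq_zero (Finset.mem_Ioi.mpr hlt) ?_))
  rw [h, sub_self, theta_zero]

lemma analyticAt_thetaVandermonde (hτ : 0 < τ.im) (z : Fin n → ℂ) :
    AnalyticAt ℂ (thetaVandermonde τ) z := by
  have hθ (u : ℂ) : AnalyticAt ℂ (theta τ) u := (differentiable_theta hτ).analyticAt u
  have hpi (i : Fin n) : AnalyticAt ℂ (fun z : Fin n → ℂ => z i) z :=
    (ContinuousLinearMap.proj (R := ℂ) (φ := fun _ : Fin n => ℂ) i).analyticAt z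
  exact ((hθ _).fun_comp (Finset.univ.analyticAt_fun_sum fun i _ => hpi i)).mul
    (Finset.analyticAt_fun_prod _ fun i _ => Finset.analyticAt_fun_prod _ fun j _ =>
      (hθ _).fun_comp ((hpi j).sub (hpi i)))

/-- Evaluation of theta functions of level `n` at `n` points. -/
def thetaEval (τ : ℂ) (w : Fin n → ℂ) : thetaSpace τ n 0 →ₗ[ℂ] (Fin n → ℂ) :=
  (LinearMap.funLeft ℂ ℂ w).comp (thetaSpace τ n 0).subtype

lemma thetaEval_surjective (hτ : 0 < τ.im) {w : Fin n → ℂ} (hw : thetaVandermonde τ w ≠ 0) :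
    Function.Surjective (thetaEval τ w) := by
  intro b
  -- Lagrange interpolation
  refine ⟨∑ k, (b k / thetaVandermonde τ w) •
    ⟨_, thetaVandermonde_update_mem_thetaSpace hτ w k⟩, ?_⟩
  rw [map_sum]
  ext l
  simp only [map_smul, Finset.sum_apply, Pi.smul_apply, thetaEval, LinearMap.comp_apply,
    Submodule.subtype_apply, LinearMap.funLeft_apply, smul_eq_mul]
  rw [Finset.sum_eq_single l, Function.update_eq_self, div_mul_cancel₀ _ hw]
  · intro k _ hkl
    rw [thetaVandermonde_eq_zero_of_eq τ (z := Function.update w k (w l)) hkl (by simp [hkl.symm]),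
      mul_zero]
  · simp

lemma thetaEval_injective [NeZero n] (hτ : 0 < τ.im) {w : Fin n → ℂ}
    (hw : thetaVandermonde τ w ≠ 0) : Function.Injective (thetaEval τ w) := by
  have hcoeffs := thetaCoeffs_injective τ n 0
  have : FiniteDimensional ℂ (thetaSpace τ n 0) := .of_injective _ hcoeffs
  have heval := thetaEval_surjective hτ hw
  exact (LinearMap.injective_iff_surjective_of_finrank_eq_finrank
    (le_antisymm (LinearMap.finrank_le_finrank_of_injective hcoeffs)
      (LinearMap.finrank_le_finrank_of_surjective heval))).mpr heval

lemma eq_of_forall_apply_eq [NeZero n] (hτ : 0 < τ.im) {w : Fin n → ℂ}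
    (hw : thetaVandermonde τ w ≠ 0) {f g : ℂ → ℂ} (hf : f ∈ thetaSpace τ n 0)
    (hg : g ∈ thetaSpace τ n 0) (h : ∀ k, f (w k) = g (w k)) : f = g :=
  congrArg Subtype.val (@thetaEval_injective n τ _ hτ w hw ⟨f, hf⟩ ⟨g, hg⟩ (funext h))

/-- The matrix of the values of the theta functions of level `n` at `n` points. -/
def thetaMatrix (τ : ℂ) (z : Fin n → ℂ) : Matrix (Fin n) (Fin n) ℂ :=
  Matrix.of fun j k => thetaLevel n τ ((j : ℕ) + 1) (z k)

lemma det_thetaMatrix_ne_zero [NeZero n] (hτ : 0 < τ.im) {w : Fin n → ℂ}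
    (hw : thetaVandermonde τ w ≠ 0) : (thetaMatrix τ w).det ≠ 0 := by
  intro hdet
  obtain ⟨a, ha, hvec⟩ := Matrix.exists_vecMul_eq_zero_iff.mpr hdet
  have hcomb : ∑ j, a j • thetaLevel n τ ((j : ℕ) + 1) = 0 :=
    eq_of_forall_apply_eq hτ hw
      (Submodule.sum_mem _ fun j _ => Submodule.smul_mem _ _ (thetaLevel_mem_thetaSpace hτ _))
      (Submodule.zero_mem _) fun k => by
        simpa [Matrix.vecMul, dotProduct, thetaMatrix] using congrFun hvec k
  exact ha (funext (Fintype.linearIndependent_iff.mp (linearIndependent_thetaLevel hτ) a hcomb))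

lemma thetaMatrix_update (τ : ℂ) (w : Fin n → ℂ) (l : Fin n) (y : ℂ) :
    thetaMatrix τ (Function.update w l y) =
      (thetaMatrix τ w).updateCol l fun j => thetaLevel n τ ((j : ℕ) + 1) y := by
  ext j k
  rcases eq_or_ne k l with rfl | hk <;> simp [thetaMatrix, *]

lemma det_thetaMatrix_update_mem_thetaSpace (hτ : 0 < τ.im) (w : Fin n → ℂ) (l : Fin n) :
    (fun y => (thetaMatrix τ (Function.update w l y)).det) ∈ thetaSpace τ n 0 := by
  have : NeZero n := ⟨l.pos.ne'⟩
  have hexpand : (fun y => (thetaMatrix τ (Function.update w l y)).det) =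
      ∑ j, (thetaMatrix τ w).adjugate l j • thetaLevel n τ ((j : ℕ) + 1) := by
    ext y
    rw [thetaMatrix_update, ← Matrix.cramer_apply, Matrix.cramer_eq_adjugate_mulVec]
    simp [Matrix.mulVec, dotProduct]
  rw [hexpand]
  exact Submodule.sum_mem _ fun j _ => Submodule.smul_mem _ _ (thetaLevel_mem_thetaSpace hτ _)

lemma det_thetaMatrix_eq_zero_of_eq (τ : ℂ) {z : Fin n → ℂ} {i j : Fin n} (hij : i ≠ j)
    (h : z i = z j) : (thetaMatrix τ z).det = 0 :=
  Matrix.det_zero_of_column_eq hij fun k => by simp [thetaMatrix, h]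

lemma analyticAt_det_thetaMatrix [NeZero n] (hτ : 0 < τ.im) (z : Fin n → ℂ) :
    AnalyticAt ℂ (fun z : Fin n → ℂ => (thetaMatrix τ z).det) z := by
  have hpi (i : Fin n) : AnalyticAt ℂ (fun z : Fin n → ℂ => z i) z :=
    (ContinuousLinearMap.proj (R := ℂ) (φ := fun _ : Fin n => ℂ) i).analyticAt z
  simp only [Matrix.det_apply']
  exact Finset.analyticAt_fun_sum _ fun σ _ => analyticAt_const.mul
    (Finset.analyticAt_fun_prod _ fun i _ =>
      ((differentiable_thetaLevel hτ _).analyticAt _).fun_comp (hpi i))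

lemma det_thetaMatrix_update_mul [NeZero n] (hτ : 0 < τ.im) {w : Fin n → ℂ}
    (hw : thetaVandermonde τ w ≠ 0) (l : Fin n) (y : ℂ) :
    (thetaMatrix τ (Function.update w l y)).det * thetaVandermonde τ w =
      (thetaMatrix τ w).det * thetaVandermonde τ (Function.update w l y) := by
  have hmem := det_thetaMatrix_update_mem_thetaSpace hτ w l
  have hmem' := thetaVandermonde_update_mem_thetaSpace hτ w l
  have heq := eq_of_forall_apply_eq hτ hw (Submodule.smul_mem _ (thetaVandermonde τ w) hmem)
    (Submodule.smul_mem _ (thetaMatrix τ w).det hmem') fun k => ?_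
  · simpa [mul_comm] using congrFun heq y
  rcases eq_or_ne k l with rfl | hk
  · simp [mul_comm]
  · have hkl : Function.update w l (w k) k = Function.update w l (w k) l := by simp [hk]
    simp [det_thetaMatrix_eq_zero_of_eq τ hk hkl, thetaVandermonde_eq_zero_of_eq τ hk hkl]

lemma det_thetaMatrix_piecewise_mul [NeZero n] (hτ : 0 < τ.im) {z w : Fin n → ℂ}
    (h : ∀ K : Finset (Fin n), thetaVandermonde τ (K.piecewise z w) ≠ 0) (K : Finset (Fin n)) :
    (thetaMatrix τ (K.piecewise z w)).det * thetaVandermonde τ w =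
      (thetaMatrix τ w).det * thetaVandermonde τ (K.piecewise z w) := by
  induction K using Finset.induction_on with
  | empty => simp
  | insert k K _ ih =>
    rw [Finset.piecewise_insert]
    apply mul_right_cancel₀ (h K)
    linear_combination thetaVandermonde τ w * det_thetaMatrix_update_mul hτ (h K) k (z k) +
      thetaVandermonde τ (Function.update (K.piecewise z w) k (z k)) * ih

-- Near a point in general position the coordinates can be changed one at a time; the identity
-- theorem then removes the genericity.
lemma det_thetaMatrix_mul_of_ne_zero [NeZero n] (hτ : 0 < τ.im) {w : Fin n → ℂ}
    (hw : thetaVandermonde τ w ≠ 0) (z : Fin n → ℂ) :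
    (thetaMatrix τ z).det * thetaVandermonde τ w =
      (thetaMatrix τ w).det * thetaVandermonde τ z := by
  have hgeneral : ∀ᶠ z in 𝓝 w, ∀ K : Finset (Fin n),
      thetaVandermonde τ (K.piecewise z w) ≠ 0 := by
    refine eventually_all.mpr fun K => ?_
    have hpiece : Continuous fun z : Fin n → ℂ => K.piecewise z w := by
      refine continuous_pi fun i => ?_
      by_cases hi : i ∈ K <;> simp only [Finset.piecewise, hi, if_true, if_false] <;> fun_prop
    have hcont : ContinuousAt (fun z => thetaVandermonde τ (K.piecewise z w)) w :=
      (analyticAt_thetaVandermonde hτ _).continuousAt.comp hpiece.continuousAt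
    exact hcont.eventually_ne (by rwa [Finset.piecewise_same])
  refine congrFun (AnalyticOnNhd.eq_of_eventuallyEq (𝕜 := ℂ) (z₀ := w)
    (f := fun z => (thetaMatrix τ z).det * thetaVandermonde τ w)
    (g := fun z => (thetaMatrix τ w).det * thetaVandermonde τ z)
    (fun z _ => (analyticAt_det_thetaMatrix hτ z).mul analyticAt_const)
    (fun z _ => analyticAt_const.mul (analyticAt_thetaVandermonde hτ z))
    (hgeneral.mono fun z hz => ?_)) z
  simpa using det_thetaMatrix_piecewise_mul hτ hz Finset.univ

lemma det_thetaMatrix_mul_thetaVandermonde [NeZero n] (hτ : 0 < τ.im) (z w : Fin n → ℂ) :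
    (thetaMatrix τ z).det * thetaVandermonde τ w =
      (thetaMatrix τ w).det * thetaVandermonde τ z := by
  by_cases hw : thetaVandermonde τ w = 0
  · by_cases hz : thetaVandermonde τ z = 0
    · rw [hw, hz, mul_zero, mul_zero]
    · exact (det_thetaMatrix_mul_of_ne_zero hτ hz w).symm
  · exact det_thetaMatrix_mul_of_ne_zero hτ hw z

end ThetaDet

/-! ### Minors -/

section Minors

variable {ι m R : Type*}

lemma exists_perm_orderEmbOfFin_comp [LinearOrder ι] {d : ℕ} {k : Fin d → ι}
    (hk : Function.Injective k) {S : Finset ι} (hS : S.card = d) (h : Set.range k = S) :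
    ∃ π : Equiv.Perm (Fin d), S.orderEmbOfFin hS ∘ π = k := by
  refine ⟨((Equiv.ofInjective k hk).trans (Equiv.setCongr h)).trans
    (S.orderIsoOfFin hS).symm.toEquiv, funext fun i => ?_⟩
  exact congrArg Subtype.val ((S.orderIsoOfFin hS).apply_symm_apply
    ((Equiv.setCongr h) (Equiv.ofInjective k hk i)))

lemma prod_mul_det_submatrix_comp_perm [CommRing R] [Fintype m] [DecidableEq m]
    (P Q : Matrix ι ι R) (a k : m → ι) (π : Equiv.Perm m) :
    (∏ r, Q (a (π r)) (k (π r))) * (P.submatrix (k ∘ π) (a ∘ π)).det =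
      (∏ r, Q (a r) (k r)) * (P.submatrix k a).det := by
  rw [Equiv.prod_comp π fun r => Q (a r) (k r), ← Matrix.submatrix_submatrix,
    Matrix.det_submatrix_equiv_self]

variable [Fintype ι]

lemma sum_injective_eq_sum_orderEmbOfFin [LinearOrder ι] [AddCommMonoid R] {d : ℕ}
    (G : (Fin d → ι) → R) :
    ∑ k : Fin d → ι with Function.Injective k, G k =
      ∑ S : {S : Finset ι // S.card = d}, ∑ π : Equiv.Perm (Fin d),
        G (S.1.orderEmbOfFin S.2 ∘ π) := by
  rw [Finset.sum_sigma' Finset.univ (fun _ => Finset.univ)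
    (fun (S : {S : Finset ι // S.card = d}) (π : Equiv.Perm (Fin d)) =>
      G (S.1.orderEmbOfFin S.2 ∘ π))]
  have hrange (S : Finset ι) (hS : S.card = d) (π : Equiv.Perm (Fin d)) :
      Set.range (S.orderEmbOfFin hS ∘ π) = S := by
    rw [π.surjective.range_comp, Finset.range_orderEmbOfFin]
  refine (Finset.sum_bij (fun p _ => p.1.1.orderEmbOfFin p.1.2 ∘ p.2) ?_ ?_ ?_
    fun _ _ => rfl).symm
  · rintro ⟨S, π⟩ _
    simpa using (S.1.orderEmbOfFin S.2).injective.comp π.injective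
  · rintro ⟨⟨S, hS⟩, π⟩ _ ⟨⟨S', hS'⟩, π'⟩ _ h
    obtain rfl : S = S' := by
      have := hrange S hS π
      rwa [h, hrange, Finset.coe_inj, eq_comm] at this
    obtain rfl : π = π' := Equiv.ext fun i => (S.orderEmbOfFin hS).injective (congrFun h i)
    rfl
  · intro k hk
    have hk : Function.Injective k := by simpa using hk
    have hcard : (Finset.univ.image k).card = d := by
      rw [Finset.card_image_of_injective _ hk, Finset.card_univ, Fintype.card_fin]
    obtain ⟨π, hπ⟩ := exists_perm_orderEmbOfFin_comp hk hcard (by simp)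
    exact ⟨⟨⟨_, hcard⟩, π⟩, Finset.mem_univ _, hπ⟩

lemma sum_injective_eq_factorial_nsmul_sum [LinearOrder ι] [AddCommMonoid R] {d : ℕ}
    {G : (Fin d → ι) → R} (hG : ∀ k (π : Equiv.Perm (Fin d)), G (k ∘ π) = G k) :
    ∑ k : Fin d → ι with Function.Injective k, G k =
      d.factorial • ∑ S : {S : Finset ι // S.card = d}, G (S.1.orderEmbOfFin S.2) := by
  rw [sum_injective_eq_sum_orderEmbOfFin, Finset.smul_sum]
  refine Finset.sum_congr rfl fun S _ => ?_
  simp only [hG, Finset.sum_const, Finset.card_univ, Fintype.card_perm, Fintype.card_fin]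

lemma sum_comp_perm_injective [DecidableEq ι] [AddCommMonoid R] {d : ℕ} (G : (Fin d → ι) → R)
    (π : Equiv.Perm (Fin d)) :
    ∑ k : Fin d → ι with Function.Injective k, G (k ∘ π) =
      ∑ k : Fin d → ι with Function.Injective k, G k := by
  refine Finset.sum_equiv (π.symm.arrowCongr (Equiv.refl ι)) (fun k => ?_) fun k _ => ?_
  · simp [Equiv.arrowCongr]
  · rfl

variable [CommRing R]

lemma det_mul_eq_sum_det_submatrix [Fintype m] [DecidableEq m]
    (P : Matrix m ι R) (Q : Matrix ι m R) :
    (P * Q).det = ∑ a : m → ι, (∏ r, Q (a r) r) * (P.submatrix id a).det := by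
  simp_rw [Matrix.det_apply', Finset.mul_sum]
  rw [Finset.sum_comm]
  refine Finset.sum_congr rfl fun σ _ => ?_
  simp only [Matrix.submatrix_apply, Matrix.mul_apply, id_eq]
  rw [Finset.prod_univ_sum, Finset.mul_sum, Fintype.piFinset_univ]
  refine Finset.sum_congr rfl fun a _ => ?_
  rw [Finset.prod_mul_distrib]
  ring

-- Cauchy–Binet: both sides are `1 / d!` times a sum over pairs of injective tuples.
lemma sum_prod_mul_det_submatrix_eq_sum_det_mul_submatrix [LinearOrder ι]
    [IsAddTorsionFree R] {d : ℕ} (P Q : Matrix ι ι R) {F : (Fin d → ι) → R}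
    (hF : ∀ k (π : Equiv.Perm (Fin d)), F (k ∘ π) = F k) :
    ∑ S : {S : Finset ι // S.card = d}, ∑ k : Fin d → ι with Function.Injective k,
        (∏ r, Q (S.1.orderEmbOfFin S.2 r) (k r)) *
          (P.submatrix k (S.1.orderEmbOfFin S.2)).det * F k =
      ∑ K : {S : Finset ι // S.card = d},
        ((P * Q).submatrix (K.1.orderEmbOfFin K.2) (K.1.orderEmbOfFin K.2)).det *
          F (K.1.orderEmbOfFin K.2) := by
  let T (a k : Fin d → ι) : R := (∏ r, Q (a r) (k r)) * (P.submatrix k a).det * F k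
  have hT (a k : Fin d → ι) (π : Equiv.Perm (Fin d)) : T (a ∘ π) (k ∘ π) = T a k := by
    simp only [T, hF, Function.comp_apply, prod_mul_det_submatrix_comp_perm]
  have hT_sum (k : Fin d → ι) :
      ∑ a with Function.Injective a, T a k = ((P * Q).submatrix k k).det * F k := by
    rw [Matrix.submatrix_mul_equiv P Q k (Equiv.refl ι) k |>.symm, det_mul_eq_sum_det_submatrix,
      Finset.sum_mul]
    refine Finset.sum_filter_of_ne fun a _ ha => ?_
    by_contra hinj
    obtain ⟨r, s, hrs, hne⟩ := Function.not_injective_iff.mp hinj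
    refine ha ?_
    simp only [T]
    rw [Matrix.det_zero_of_column_eq hne fun t => by simp [hrs], mul_zero, zero_mul]
  apply nsmul_right_injective d.factorial_ne_zero
  dsimp only
  rw [← sum_injective_eq_factorial_nsmul_sum
    (G := fun a => ∑ k with Function.Injective k, T a k) fun a π => ?_,
    ← sum_injective_eq_factorial_nsmul_sum
    (G := fun k => ((P * Q).submatrix k k).det * F k) fun k π => ?_, Finset.sum_comm]
  · exact Finset.sum_congr rfl fun k _ => hT_sum k
  · rw [← Matrix.submatrix_submatrix, Matrix.det_submatrix_equiv_self, hF]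
  · rw [← sum_comp_perm_injective (T (a ∘ π)) π]
    simp only [hT]

variable [DecidableEq ι]

lemma inv_mul_apply_of_col_eq {A B : Matrix ι ι R} (hB : IsUnit B.det) {j : ι}
    (h : ∀ i, B i j = A i j) (i : ι) : (B⁻¹ * A) i j = (1 : Matrix ι ι R) i j := by
  rw [← Matrix.nonsing_inv_mul _ hB]
  simp only [Matrix.mul_apply, h]

lemma inv_apply_eq_sum {A : Matrix ι ι R} (hA : IsUnit A.det) (B : Matrix ι ι R) (i j : ι) :
    B⁻¹ i j = ∑ l, (B⁻¹ * A) i l * A⁻¹ l j := by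
  rw [← Matrix.mul_apply, Matrix.mul_assoc, Matrix.mul_nonsing_inv _ hA, Matrix.mul_one]

lemma det_inv_rows_of_injective {d : ℕ} {A : Matrix ι ι R} {B : Fin d → Matrix ι ι R}
    (hA : IsUnit A.det) (hB : ∀ r, IsUnit (B r).det) {k : Fin d → ι} (a : Fin d → ι)
    (h : ∀ r j, (∀ s < r, k s ≠ j) → ∀ i, B r i j = A i j) (hk : Function.Injective k) :
    (Matrix.of fun r s => (B r)⁻¹ (k r) (a s)).det = (A⁻¹.submatrix k a).det := by
  let C : Matrix (Fin d) (Fin d) R := Matrix.of fun r t => ((B r)⁻¹ * A) (k r) (k t)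
  have hC (r t : Fin d) (hrt : r ≤ t) : C r t = (1 : Matrix ι ι R) (k r) (k t) :=
    inv_mul_apply_of_col_eq (hB r) (h r _ fun s hs => hk.ne (hs.trans_le hrt).ne) _
  have hdet : C.det = 1 := by
    rw [Matrix.det_of_isLowerTriangular]
    · exact Finset.prod_eq_one fun r _ => by rw [hC r r le_rfl, Matrix.one_apply_eq]
    · intro r t hrt
      have hrt : r < t := hrt
      rw [hC r t hrt.le, Matrix.one_apply_ne (hk.ne hrt.ne)]
  have hmul : (Matrix.of fun r s => (B r)⁻¹ (k r) (a s)) = C * A⁻¹.submatrix k a := by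
    ext r s
    rw [Matrix.of_apply, inv_apply_eq_sum hA, Matrix.mul_apply]
    refine (Fintype.sum_of_injective k hk _ _ (fun j hj => ?_) fun _ => rfl).symm
    have hj (s : Fin d) : k s ≠ j := fun hs => hj ⟨s, hs⟩
    rw [inv_mul_apply_of_col_eq (hB r) (h r j fun s _ => hj s), Matrix.one_apply_ne (hj r),
      zero_mul]
  rw [hmul, Matrix.det_mul, hdet, one_mul]

lemma det_inv_rows_of_not_injective {d : ℕ} {A : Matrix ι ι R} {B : Fin d → Matrix ι ι R}
    (hA : IsUnit A.det) (hB : ∀ r, IsUnit (B r).det) {k : Fin d → ι} (a : Fin d → ι)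
    (h : ∀ r j, (∀ s < r, k s ≠ j) → ∀ i, B r i j = A i j) (hk : ¬ Function.Injective k) :
    (Matrix.of fun r s => (B r)⁻¹ (k r) (a s)).det = 0 := by
  have hspan (r : Fin d) : (fun s => (B r)⁻¹ (k r) (a s)) ∈
      Submodule.span R (Set.range fun t s => A⁻¹ (k t) (a s)) := by
    have hexpand : (fun s => (B r)⁻¹ (k r) (a s)) =
        ∑ j, ((B r)⁻¹ * A) (k r) j • fun s => A⁻¹ j (a s) := by
      ext s
      simp [inv_apply_eq_sum hA (B r)]
    rw [hexpand]
    refine Submodule.sum_mem _ fun j _ => ?_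
    by_cases hj : ∃ t, k t = j
    · obtain ⟨t, rfl⟩ := hj
      exact Submodule.smul_mem _ _ (Submodule.subset_span ⟨t, rfl⟩)
    · have hj (s : Fin d) : k s ≠ j := fun hs => hj ⟨s, hs⟩
      rw [inv_mul_apply_of_col_eq (hB r) (h r j fun s _ => hj s), Matrix.one_apply_ne (hj r),
        zero_smul]
      exact Submodule.zero_mem _
  choose C hC using fun r => (Submodule.mem_span_range_iff_exists_fun R).mp (hspan r)
  have hmul : (Matrix.of fun r s => (B r)⁻¹ (k r) (a s)) =
      Matrix.of C * A⁻¹.submatrix k a := by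
    ext r s
    simpa [Matrix.mul_apply] using (congrFun (hC r) s).symm
  obtain ⟨r, s, hrs, hne⟩ := Function.not_injective_iff.mp hk
  rw [hmul, Matrix.det_mul,
    Matrix.det_zero_of_row_eq hne (M := A⁻¹.submatrix k a) (by ext; simp [hrs]), mul_zero]

lemma inv_mul_piecewise_apply {A : Matrix ι ι R} (hA : IsUnit A.det) (B : Matrix ι ι R)
    (K : Finset ι) (i j : ι) :
    (A⁻¹ * Matrix.of fun i => K.piecewise (B i) (A i)) i j =
      if j ∈ K then (A⁻¹ * B) i j else (1 : Matrix ι ι R) i j := by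
  rw [← Matrix.nonsing_inv_mul _ hA]
  split_ifs with hj <;> simp [Matrix.mul_apply, hj]

lemma det_mul_det_inv_mul_submatrix [Fintype m] [DecidableEq m] {A : Matrix ι ι R}
    (hA : IsUnit A.det) (B : Matrix ι ι R) {K : Finset ι} (e : m ≃ K) :
    A.det * ((A⁻¹ * B).submatrix (fun r => (e r : ι)) fun r => (e r : ι)).det =
      (Matrix.of fun i => K.piecewise (B i) (A i)).det := by
  set C := A⁻¹ * Matrix.of fun i => K.piecewise (B i) (A i) with hC
  have hAC : A * C = Matrix.of fun i => K.piecewise (B i) (A i) :=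
    Matrix.mul_nonsing_inv_cancel_left _ _ hA
  have hblock : C.toSquareBlockProp (· ∉ K) = 1 := by
    ext i j
    simp [Matrix.toSquareBlockProp_def, hC, inv_mul_piecewise_apply hA, j.2, Matrix.one_apply,
      Subtype.ext_iff]
  have hminor : (C.toSquareBlockProp (· ∈ K)).submatrix e e =
      (A⁻¹ * B).submatrix (fun r => (e r : ι)) fun r => (e r : ι) := by
    ext i j
    simp [Matrix.toSquareBlockProp_def, hC, inv_mul_piecewise_apply hA]
  rw [← hAC, Matrix.det_mul, Matrix.twoBlockTriangular_det' C (· ∈ K), hblock, Matrix.det_one,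
    mul_one, ← hminor]
  · rw [Matrix.det_submatrix_equiv_self]
    congr!
  intro i hi j hj
  rw [hC, inv_mul_piecewise_apply hA, if_neg hj, Matrix.one_apply_ne]
  rintro rfl
  exact hj hi

end Minors

/-! ### The trace of the fused operator -/

section FusedTrace

variable {n : ℕ} (W : Submodule ℂ (EuclideanSpace ℂ (Fin n)))

lemma pairBar_add_smul (x y : W) (h : ℂ) (k : Fin n) :
    pairBar W (x + h • y) k = pairBar W x k + h * pairBar W y k := by
  simp only [pairBar, Submodule.coe_add, Submodule.coe_smul, PiLp.add_apply, PiLp.smul_apply,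
    smul_eq_mul, Finset.sum_add_distrib, ← Finset.mul_sum]
  ring

lemma pairBar_sum {ι : Type*} (s : Finset ι) (y : ι → W) (k : Fin n) :
    pairBar W (∑ i ∈ s, y i) k = ∑ i ∈ s, pairBar W (y i) k := by
  classical
  induction s using Finset.induction_on with
  | empty => simp [pairBar]
  | insert i s hi ih =>
    rw [Finset.sum_insert hi, Finset.sum_insert hi, ← ih]
    simpa using pairBar_add_smul W (y i) (∑ i ∈ s, y i) 1 k

lemma sum_pairBar [NeZero n] (x : W) : ∑ k, pairBar W x k = 0 := by
  simp only [pairBar, Finset.sum_sub_distrib, Finset.sum_const, Finset.card_univ,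
    Fintype.card_fin, nsmul_eq_mul]
  rw [mul_div_cancel₀ _ (NeZero.ne (n : ℂ)), sub_self]

variable {W}

-- The orthogonal complement of `W` consists of vectors with equal coordinates.
lemma exists_forall_dir_apply_eq (hW : weightSpace n ≤ W) (i : Fin n) :
    ∃ a : ℂ, ∀ k, (dir W i : EuclideanSpace ℂ (Fin n)) k = (if i = k then 1 else 0) - a := by
  have hmem : EuclideanSpace.single i 1 - (dir W i : EuclideanSpace ℂ (Fin n)) ∈
      Submodule.span ℂ {∑ i : Fin n, EuclideanSpace.single i (1 : ℂ)} := by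
    rw [← Submodule.orthogonal_orthogonal (Submodule.span ℂ _)]
    exact Submodule.orthogonal_le hW (W.sub_starProjection_mem_orthogonal _)
  obtain ⟨a, ha⟩ := Submodule.mem_span_singleton.mp hmem
  refine ⟨a, fun k => ?_⟩
  have hk := congrArg (fun v : EuclideanSpace ℂ (Fin n) => v k) ha
  simp only [PiLp.smul_apply, WithLp.ofLp_sum, PiLp.ofLp_single, Finset.sum_apply,
    Finset.sum_pi_single, Finset.mem_univ, if_true, smul_eq_mul, mul_one, PiLp.sub_apply,
    PiLp.single_apply, eq_comm (a := k)] at hk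
  rw [hk, sub_sub_cancel]

lemma pairBar_dir [NeZero n] (hW : weightSpace n ≤ W) (i k : Fin n) :
    pairBar W (dir W i) k = (if i = k then 1 else 0) - 1 / n := by
  obtain ⟨a, ha⟩ := exists_forall_dir_apply_eq hW i
  simp only [pairBar, ha, Finset.sum_sub_distrib, Finset.sum_ite_eq, Finset.mem_univ, if_true,
    Finset.sum_const, Finset.card_univ, Fintype.card_fin, nsmul_eq_mul]
  field_simp [NeZero.ne (n : ℂ)]
  ring

/-- The point reached from `x` after the first `r` of the steps `h • dir W (k s)`, at which the
`r`-th factor of the fused L-operator evaluates its coefficients. -/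
def pathPoint (h : ℂ) (x : W) {d : ℕ} (k : Fin d → Fin n) (r : ℕ) : W :=
  x + h • ∑ s : Fin d, if (s : ℕ) < r then dir W (k s) else 0

lemma pathPoint_zero (h : ℂ) (x : W) {d : ℕ} (k : Fin d → Fin n) : pathPoint h x k 0 = x := by
  simp [pathPoint]

lemma pathPoint_cons_succ (h : ℂ) (x : W) {d : ℕ} (k₀ : Fin n) (k : Fin d → Fin n) (r : ℕ) :
    pathPoint h x (Fin.cons k₀ k) (r + 1) = pathPoint h (x + h • dir W k₀) k r := by
  simp [pathPoint, Fin.sum_univ_succ, smul_add, add_assoc]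

lemma foldr_Lop (τ c h : ℂ) (f : W → ℂ) {d : ℕ} (U : Fin d → ℂ) (a b : Fin d → Fin n) (x : W) :
    (List.finRange d).foldr (fun r g => Lop W τ c h (U r) (a r) (b r) g) f x =
      ∑ k : Fin d → Fin n,
        (∏ r : Fin d, outVec W τ (U r + c * h) (pathPoint h x k r) (b r) (k r)) *
          (∏ r : Fin d, inVec W τ (U r) (pathPoint h x k r) (k r) (a r)) *
          f (x + h • ∑ s, dir W (k s)) := by
  induction d generalizing x with
  | zero => simp
  | succ d ih =>
    rw [List.finRange_succ, List.foldr_cons, List.foldr_map, Lop,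
      ← (Fin.consEquiv fun _ => Fin n).sum_comp, Fintype.sum_prod_type]
    refine Finset.sum_congr rfl fun k₀ _ => ?_
    rw [ih (fun r => U r.succ) (fun r => a r.succ) (fun r => b r.succ), Finset.mul_sum]
    refine Finset.sum_congr rfl fun k _ => ?_
    simp only [Fin.consEquiv, Equiv.coe_fn_mk, Fin.prod_univ_succ, Fin.sum_univ_succ,
      Fin.cons_zero, Fin.cons_succ, Fin.val_zero, Fin.val_succ, pathPoint_zero,
      pathPoint_cons_succ, smul_add, add_assoc]
    ring

lemma pairBar_pathPoint [NeZero n] (hW : weightSpace n ≤ W) (h : ℂ) (x : W) {d : ℕ}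
    {k : Fin d → Fin n} {r : Fin d} {j : Fin n} (hj : ∀ s < r, k s ≠ j) :
    pairBar W (pathPoint h x k r) j = pairBar W x j - (r : ℕ) * h / n := by
  have hstep (s : Fin d) : pairBar W (if (s : ℕ) < r then dir W (k s) else 0) j =
      (if (s : ℕ) < r then 1 else 0) * (-1 / n) := by
    split_ifs with hs
    · rw [pairBar_dir hW, if_neg (hj s hs)]
      ring
    · simp [pairBar]
  have hcard : ∑ s : Fin d, (if (s : ℕ) < r then (1 : ℂ) else 0) = (r : ℕ) := by
    rw [Finset.sum_boole, Fin.card_filter_val_lt, min_eq_right r.2.le]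
  simp only [pathPoint, pairBar_add_smul, pairBar_sum, hstep]
  rw [← Finset.sum_mul, hcard]
  ring

-- The shift `u ↦ u - r h` of the spectral parameter compensates the displacement of the path.
lemma outVec_pathPoint [NeZero n] (hW : weightSpace n ≤ W) (τ u h : ℂ) (x : W) {d : ℕ}
    {k : Fin d → Fin n} {r : Fin d} {j : Fin n} (hj : ∀ s < r, k s ≠ j) (i : Fin n) :
    outVec W τ (u - (r : ℕ) * h) (pathPoint h x k r) i j = outVec W τ u x i j := by
  simp only [outVec, Matrix.of_apply]
  rw [pairBar_pathPoint hW h x hj]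
  congr 2
  ring

lemma outVec_eq (τ u : ℂ) (x : W) :
    outVec W τ u x = (I * ModularForm.eta τ)⁻¹ • thetaMatrix τ fun k => u / n - pairBar W x k := by
  ext j k
  simp [outVec, thetaMatrix, div_eq_inv_mul]

lemma thetaVandermonde_pairBar [NeZero n] (τ u : ℂ) (x : W) :
    thetaVandermonde τ (fun k => u / n - pairBar W x k) = theta τ u * Delta W τ x := by
  rw [thetaVandermonde, Delta, Finset.sum_sub_distrib, sum_pairBar]
  congr 2
  · simp only [Finset.sum_const, Finset.card_univ, Fintype.card_fin, nsmul_eq_mul, sub_zero]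
    exact mul_div_cancel₀ _ (NeZero.ne (n : ℂ))
  · ext i
    refine Finset.prod_congr rfl fun j _ => ?_
    rw [diffBar, sub_sub_sub_cancel_left]

lemma isUnit_det_outVec [NeZero n] {τ : ℂ} (hτ : 0 < τ.im) {u : ℂ} {x : W}
    (hu : theta τ u ≠ 0) (hx : Delta W τ x ≠ 0) : IsUnit (outVec W τ u x).det := by
  have hη : I * ModularForm.eta τ ≠ 0 := mul_ne_zero I_ne_zero (ModularForm.eta_ne_zero hτ)
  rw [isUnit_iff_ne_zero, outVec_eq, Matrix.det_smul]
  refine mul_ne_zero (pow_ne_zero _ (inv_ne_zero hη)) (det_thetaMatrix_ne_zero hτ ?_)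
  rw [thetaVandermonde_pairBar]
  exact mul_ne_zero hu hx

lemma fusedL_eq_sum_injective [NeZero n] (hW : weightSpace n ≤ W) {τ c h u : ℂ} {d : ℕ} {x : W}
    (hx : IsUnit (outVec W τ u x).det)
    (hpath : ∀ (k : Fin d → Fin n) (r : Fin d),
      IsUnit (outVec W τ (u - (r : ℕ) * h) (pathPoint h x k r)).det)
    (a b : Fin d → Fin n) (f : W → ℂ) :
    fusedL W τ c h u a b f x = ∑ k : Fin d → Fin n with Function.Injective k,
      (∏ r, outVec W τ (u + c * h) x (b r) (k r)) *
        ((outVec W τ u x)⁻¹.submatrix k a).det * f (x + h • ∑ s, dir W (k s)) := by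
  have hout {k : Fin d → Fin n} (hk : Function.Injective k) (r : Fin d) :
      outVec W τ (u - (r : ℕ) * h + c * h) (pathPoint h x k r) (b r) (k r) =
        outVec W τ (u + c * h) x (b r) (k r) := by
    rw [sub_add_eq_add_sub]
    exact outVec_pathPoint hW τ (u + c * h) h x (fun s hs => hk.ne hs.ne) (b r)
  have hin (k : Fin d → Fin n) :
      ∑ σ : Equiv.Perm (Fin d), ((Equiv.Perm.sign σ : ℤ) : ℂ) *
        ∏ r : Fin d, inVec W τ (u - (r : ℕ) * h) (pathPoint h x k r) (k r) (a (σ r)) =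
      (Matrix.of fun r s : Fin d =>
        (outVec W τ (u - (r : ℕ) * h) (pathPoint h x k r))⁻¹ (k r) (a s)).det := by
    rw [← Matrix.det_transpose, Matrix.det_apply']
    rfl
  have hfactor (s B : Equiv.Perm (Fin d) → ℂ) (A F : ℂ) :
      ∑ σ, s σ * (A * B σ * F) = A * (∑ σ, s σ * B σ) * F := by
    rw [Finset.mul_sum, Finset.sum_mul]
    exact Finset.sum_congr rfl fun σ _ => by ring
  have hcol (k : Fin d → Fin n) (r : Fin d) (j : Fin n) (hj : ∀ s < r, k s ≠ j) (i : Fin n) :=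
    outVec_pathPoint hW τ u h x hj i
  simp only [fusedL, foldr_Lop τ c h f (fun r : Fin d => u - ((r : ℕ) : ℂ) * h), Finset.mul_sum]
  rw [Finset.sum_comm, Finset.sum_filter]
  refine Finset.sum_congr rfl fun k _ => ?_
  rw [hfactor, hin]
  split_ifs with hk
  · rw [det_inv_rows_of_injective hx (hpath k) a (hcol k) hk]
    congr 2
    exact Finset.prod_congr rfl fun r _ => hout hk r
  · rw [det_inv_rows_of_not_injective hx (hpath k) a (hcol k) hk, mul_zero, zero_mul]

lemma det_outVec_mul_M [NeZero n] (hW : weightSpace n ≤ W) {τ c h u : ℂ} {d : ℕ} {x : W}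
    (hx : IsUnit (outVec W τ u x).det)
    (hpath : ∀ (k : Fin d → Fin n) (r : Fin d),
      IsUnit (outVec W τ (u - (r : ℕ) * h) (pathPoint h x k r)).det) (f : W → ℂ) :
    (outVec W τ u x).det * M W τ c h u d f x =
      ∑ K ∈ Finset.powersetCard d (Finset.univ : Finset (Fin n)),
        (Matrix.of fun j => K.piecewise (outVec W τ (u + c * h) x j) (outVec W τ u x j)).det *
          f (x + h • ∑ i ∈ K, dir W i) := by
  have hsymm (k : Fin d → Fin n) (π : Equiv.Perm (Fin d)) :
      f (x + h • ∑ s, dir W ((k ∘ π) s)) = f (x + h • ∑ s, dir W (k s)) := by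
    rw [← Equiv.sum_comp π fun s => dir W (k s)]
    rfl
  simp only [M, fusedL_eq_sum_injective hW hx hpath]
  rw [sum_prod_mul_det_submatrix_eq_sum_det_mul_submatrix (outVec W τ u x)⁻¹
    (outVec W τ (u + c * h) x) hsymm, Finset.mul_sum,
    Finset.sum_subtype (p := fun S : Finset (Fin n) => S.card = d) _ (by simp)]
  refine Finset.sum_congr rfl fun K _ => ?_
  rw [← mul_assoc]
  congr 3
  · exact det_mul_det_inv_mul_submatrix hx _ (K.1.orderIsoOfFin K.2).toEquiv
  · congr 1
    rw [← Finset.sum_coe_sort K.1, ← (K.1.orderIsoOfFin K.2).toEquiv.sum_comp]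
    rfl

lemma outVec_piecewise (τ c h u : ℂ) (x : W) (K : Finset (Fin n)) :
    (Matrix.of fun j => K.piecewise (outVec W τ (u + c * h) x j) (outVec W τ u x j)) =
      (I * ModularForm.eta τ)⁻¹ • thetaMatrix τ
        fun k => u / n - pairBar W x k + if k ∈ K then c / n * h else 0 := by
  ext i j
  by_cases hj : j ∈ K
  · have harg : (u + c * h) / n - pairBar W x j = u / n - pairBar W x j + c / n * h := by ring
    simp only [outVec, thetaMatrix, Matrix.of_apply, Finset.piecewise_eq_of_mem _ _ _ hj, harg,
      Matrix.smul_apply, smul_eq_mul, if_pos hj]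
    exact div_eq_inv_mul _ _
  · simp [hj, outVec, thetaMatrix, div_eq_inv_mul]

lemma thetaVandermonde_pairBar_add [NeZero n] (hW : weightSpace n ≤ W) (τ u t : ℂ) (x : W)
    (K : Finset (Fin n)) :
    thetaVandermonde τ (fun k => u / n - pairBar W x k + if k ∈ K then t else 0) =
      theta τ (u + K.card * t) * Delta W τ (x - t • ∑ i ∈ K, dir W i) := by
  have hn := NeZero.ne (n : ℂ)
  rw [← thetaVandermonde_pairBar]
  congr 1
  ext k
  rw [sub_eq_add_neg x, ← neg_smul, pairBar_add_smul, pairBar_sum]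
  simp only [pairBar_dir hW]
  rw [Finset.sum_sub_distrib, Finset.sum_ite_eq', Finset.sum_const, nsmul_eq_mul]
  split_ifs <;> field_simp <;> ring

theorem Mdot_eq_sum [NeZero n] (hW : weightSpace n ≤ W) {τ : ℂ} (hτ : 0 < τ.im)
    {c h u : ℂ} {d : ℕ} {x : W} (hu : theta τ u ≠ 0) (hx : Delta W τ x ≠ 0)
    (hpath : ∀ (k : Fin d → Fin n) (r : Fin d),
      theta τ (u - (r : ℕ) * h) * Delta W τ (pathPoint h x k r) ≠ 0)
    (hshift : theta τ (u + d * (c / n * h)) ≠ 0) (f : W → ℂ) :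
    Mdot W τ c h u d f x = ∑ K ∈ Finset.powersetCard d (Finset.univ : Finset (Fin n)),
      Delta W τ (x - (c / n * h) • ∑ i ∈ K, dir W i) / Delta W τ x *
        f (x + h • ∑ i ∈ K, dir W i) := by
  have hdet := isUnit_det_outVec hτ hu hx
  have hM := det_outVec_mul_M (c := c) hW hdet (fun k r => isUnit_det_outVec hτ
    (left_ne_zero_of_mul (hpath k r)) (right_ne_zero_of_mul (hpath k r))) f
  have hminor {K : Finset (Fin n)} (hK : K.card = d) :
      theta τ u / theta τ (u + d * (c / n * h)) *
        (Matrix.of fun j => K.piecewise (outVec W τ (u + c * h) x j) (outVec W τ u x j)).det =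
      (outVec W τ u x).det *
        (Delta W τ (x - (c / n * h) • ∑ i ∈ K, dir W i) / Delta W τ x) := by
    have hV := det_thetaMatrix_mul_thetaVandermonde hτ
      (fun k => u / n - pairBar W x k + if k ∈ K then c / n * h else 0)
      fun k => u / n - pairBar W x k
    rw [thetaVandermonde_pairBar, thetaVandermonde_pairBar_add hW, hK] at hV
    rw [outVec_piecewise, outVec_eq, Matrix.det_smul, Matrix.det_smul, div_mul_eq_mul_div,
      ← mul_div_assoc, div_eq_div_iff hshift hx]
    linear_combination (I * ModularForm.eta τ)⁻¹ ^ Fintype.card (Fin n) * hV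
  have harg : u + c * d / n * h = u + d * (c / n * h) := by ring
  apply mul_left_cancel₀ hdet.ne_zero
  rw [Mdot, mul_left_comm, hM, Finset.mul_sum, Finset.mul_sum, harg]
  refine Finset.sum_congr rfl fun K hK => ?_
  rw [← mul_assoc, hminor (Finset.mem_powersetCard_univ.mp hK), mul_assoc]

end FusedTrace

/-! ### Iterated directional derivatives -/

section LineDerivatives

variable {𝕜 E F : Type*} [NontriviallyNormedField 𝕜] [NormedAddCommGroup E] [NormedSpace 𝕜 E]
  [NormedAddCommGroup F] [NormedSpace 𝕜 F]

/-- The iterated directional derivative of `f` along the list `L` of directions, the head of `L`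
being applied last. -/
def iteratedLineDeriv (𝕜 : Type*) [NontriviallyNormedField 𝕜] [NormedSpace 𝕜 E]
    [NormedSpace 𝕜 F] (L : List E) (f : E → F) : E → F :=
  L.foldr (fun ξ g q => lineDeriv 𝕜 g q ξ) f

lemma iteratedLineDeriv_cons (ξ : E) (L : List E) (f : E → F) (q : E) :
    iteratedLineDeriv 𝕜 (ξ :: L) f q = lineDeriv 𝕜 (iteratedLineDeriv 𝕜 L f) q ξ :=
  rfl

variable [CompleteSpace F] {f : E → F} {p : E}

lemma analyticAt_lineDeriv (hf : AnalyticAt 𝕜 f p) (ξ : E) :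
    AnalyticAt 𝕜 (fun q => lineDeriv 𝕜 f q ξ) p := by
  have hfderiv : AnalyticAt 𝕜 (fun q => fderiv 𝕜 f q ξ) p :=
    ((ContinuousLinearMap.apply 𝕜 F ξ).analyticAt _).comp hf.fderiv
  refine hfderiv.congr (hf.eventually_analyticAt.mono fun q hq => ?_)
  exact hq.differentiableAt.lineDeriv_eq_fderiv.symm

lemma hasFDerivAt_iteratedFDeriv_apply (hf : AnalyticAt 𝕜 f p) {m : ℕ} (v : Fin m → E) :
    HasFDerivAt (fun q => iteratedFDeriv 𝕜 m f q v)
      ((ContinuousMultilinearMap.apply 𝕜 (fun _ : Fin m => E) F v).comp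
        (fderiv 𝕜 (iteratedFDeriv 𝕜 m f) p)) p := by
  have hdiff : DifferentiableAt 𝕜 (iteratedFDeriv 𝕜 m f) p :=
    ((hf.contDiffAt (n := ⊤)).iteratedFDeriv_right (m := 1) (i := m) le_top).differentiableAt
      one_ne_zero
  exact (ContinuousMultilinearMap.apply 𝕜 (fun _ : Fin m => E) F v).hasFDerivAt.comp p
    hdiff.hasFDerivAt

lemma iteratedDeriv_comp_line (hf : AnalyticAt 𝕜 f p) (ξ : E) (m : ℕ) :
    iteratedDeriv m (fun h : 𝕜 => f (p + h • ξ)) 0 = iteratedFDeriv 𝕜 m f p fun _ => ξ := by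
  have hline (h : 𝕜) : HasDerivAt (fun h : 𝕜 => p + h • ξ) ξ h := by
    simpa using ((hasDerivAt_id h).smul_const ξ).const_add p
  have hanalytic : ∀ᶠ h : 𝕜 in 𝓝 0, AnalyticAt 𝕜 f (p + h • ξ) := by
    refine (hline 0).continuousAt.eventually ?_
    simpa using hf.eventually_analyticAt
  have heventually : ∀ᶠ h : 𝕜 in 𝓝 0, iteratedDeriv m (fun h : 𝕜 => f (p + h • ξ)) h =
      iteratedFDeriv 𝕜 m f (p + h • ξ) fun _ => ξ := by
    induction m with
    | zero => exact Eventually.of_forall fun h => by simp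
    | succ m ih =>
      filter_upwards [hanalytic, ih.eventually_nhds] with h hh hm
      rw [iteratedDeriv_succ, EventuallyEq.deriv_eq (f := fun h : 𝕜 =>
        iteratedFDeriv 𝕜 m f (p + h • ξ) fun _ => ξ) hm]
      exact ((hasFDerivAt_iteratedFDeriv_apply hh _).comp_hasDerivAt h (hline h)).deriv
  simpa using heventually.self_of_nhds

lemma iteratedFDeriv_eventuallyEq_iteratedLineDeriv (hf : AnalyticAt 𝕜 f p) {m : ℕ}
    (v : Fin m → E) :
    (fun q => iteratedFDeriv 𝕜 m f q v) =ᶠ[𝓝 p] iteratedLineDeriv 𝕜 (List.ofFn v) f := by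
  induction m with
  | zero => exact Eventually.of_forall fun q => by simp [iteratedLineDeriv]
  | succ m ih =>
    filter_upwards [hf.eventually_analyticAt, (ih fun i => v i.succ).eventually_nhds] with q hq hm
    have hderiv := hasFDerivAt_iteratedFDeriv_apply hq fun i => v i.succ
    rw [List.ofFn_succ, iteratedLineDeriv_cons, ← EventuallyEq.lineDeriv_eq hm,
      hderiv.differentiableAt.lineDeriv_eq_fderiv, hderiv.fderiv, iteratedFDeriv_succ_apply_left]
    rfl

end LineDerivatives

section PartialDerivatives

variable {n : ℕ} {W : Submodule ℂ (EuclideanSpace ℂ (Fin n))}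

lemma analyticAt_pd {f : W → ℂ} {x : W} (hf : AnalyticAt ℂ f x) (i : Fin n) :
    AnalyticAt ℂ (pd W i f) x :=
  analyticAt_lineDeriv hf _

lemma pdSet_insert {a : Fin n} {S : Finset (Fin n)} (ha : ∀ b ∈ S, a < b) (f : W → ℂ) :
    pdSet W (insert a S) f = pd W a (pdSet W S f) := by
  rw [pdSet, Finset.sort_insert _ (fun b hb => (ha b hb).le) fun h => lt_irrefl _ (ha a h)]
  rfl

lemma analyticAt_pdSet {f : W → ℂ} {x : W} (hf : AnalyticAt ℂ f x) (S : Finset (Fin n)) :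
    AnalyticAt ℂ (pdSet W S f) x := by
  induction S using Finset.induction_on_min with
  | empty => simpa [pdSet] using hf
  | insert a S ha ih =>
    rw [pdSet_insert ha]
    exact analyticAt_pd ih a

/-- The function `A ⊗ B` on `W × W`, through which a product of a shift of `A` with a different
shift of `B` is a single shift. -/
def tensorFun (A B : W → ℂ) (q : W × W) : ℂ := A q.1 * B q.2

lemma analyticAt_tensorFun {A B : W → ℂ} {q : W × W} (hA : AnalyticAt ℂ A q.1)
    (hB : AnalyticAt ℂ B q.2) : AnalyticAt ℂ (tensorFun A B) q :=
  (hA.fun_comp (f := Prod.fst) analyticAt_fst).mul (hB.fun_comp (f := Prod.snd) analyticAt_snd)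

lemma hasLineDerivAt_tensorFun {A B : W → ℂ} {q : W × W} (hA : AnalyticAt ℂ A q.1)
    (hB : AnalyticAt ℂ B q.2) (t : ℂ) (i : Fin n) :
    HasLineDerivAt ℂ (tensorFun A B)
      (t * pd W i A q.1 * B q.2 + A q.1 * pd W i B q.2) q (t • dir W i, dir W i) := by
  have hfst := hA.differentiableAt.hasFDerivAt.comp q hasFDerivAt_fst
  have hsnd := hB.differentiableAt.hasFDerivAt.comp q hasFDerivAt_snd
  refine ((hfst.mul hsnd).hasLineDerivAt (t • dir W i, dir W i)).congr_deriv ?_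
  simp only [pd, hA.differentiableAt.lineDeriv_eq_fderiv, hB.differentiableAt.lineDeriv_eq_fderiv,
    add_apply, smul_apply, ContinuousLinearMap.comp_apply, ContinuousLinearMap.coe_fst',
    ContinuousLinearMap.coe_snd', map_smul, smul_eq_mul, Function.comp_apply]
  ring

lemma iteratedLineDeriv_tensorFun {A B : W → ℂ} {x : W} (hA : AnalyticAt ℂ A x)
    (hB : AnalyticAt ℂ B x) (t : ℂ) (S : Finset (Fin n)) :
    iteratedLineDeriv ℂ (S.sort.map fun i => (t • dir W i, dir W i)) (tensorFun A B)
      =ᶠ[𝓝 (x, x)] fun q => ∑ J ∈ S.powerset,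
        t ^ J.card * tensorFun (pdSet W J A) (pdSet W (S \ J) B) q := by
  induction S using Finset.induction_on_min with
  | empty => exact Eventually.of_forall fun q => by simp [iteratedLineDeriv, pdSet]
  | insert a S ha ih =>
    have haS : a ∉ S := fun h => lt_irrefl _ (ha a h)
    have hanalytic : ∀ᶠ q : W × W in 𝓝 (x, x), ∀ J ∈ S.powerset,
        AnalyticAt ℂ (pdSet W J A) q.1 ∧ AnalyticAt ℂ (pdSet W (S \ J) B) q.2 := by
      refine (Finset.eventually_all _).mpr fun J _ => ?_
      exact (continuousAt_fst.eventually (analyticAt_pdSet hA J).eventually_analyticAt).and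
        (continuousAt_snd.eventually (analyticAt_pdSet hB (S \ J)).eventually_analyticAt)
    filter_upwards [ih.eventually_nhds, hanalytic] with q hq hqa
    have hderiv : HasLineDerivAt ℂ (fun q => ∑ J ∈ S.powerset,
          t ^ J.card * tensorFun (pdSet W J A) (pdSet W (S \ J) B) q)
        (∑ J ∈ S.powerset, t ^ J.card * (t * pd W a (pdSet W J A) q.1 * pdSet W (S \ J) B q.2 +
          pdSet W J A q.1 * pd W a (pdSet W (S \ J) B) q.2)) q (t • dir W a, dir W a) :=
      HasDerivAt.fun_sum fun J hJ =>
        (hasLineDerivAt_tensorFun (hqa J hJ).1 (hqa J hJ).2 t a).const_mul _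
    rw [Finset.sort_insert _ (fun b hb => (ha b hb).le) haS, List.map_cons,
      iteratedLineDeriv_cons, EventuallyEq.lineDeriv_eq hq, hderiv.lineDeriv,
      Finset.sum_powerset_insert haS, ← Finset.sum_add_distrib]
    refine Finset.sum_congr rfl fun J hJ => ?_
    have hJS := Finset.mem_powerset.mp hJ
    have haJ : a ∉ J := fun h => haS (hJS h)
    rw [Finset.insert_sdiff_of_notMem _ haJ, Finset.insert_sdiff_insert,
      Finset.sdiff_insert_of_notMem haS, Finset.card_insert_of_notMem haJ,
      pdSet_insert fun b hb => ha b (hJS hb),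
      pdSet_insert fun b hb => ha b (Finset.sdiff_subset hb)]
    simp only [tensorFun]
    ring

lemma ofFn_comp_orderEmbOfFin {ι α : Type*} [LinearOrder ι] (v : ι → α) {m : ℕ} {S : Finset ι}
    (hS : S.card = m) : List.ofFn (fun i => v (S.orderEmbOfFin hS i)) = S.sort.map v := by
  apply List.ext_getElem
  · simp [hS]
  · intro i h₁ h₂
    simp [Finset.orderEmbOfFin_apply]

lemma iteratedFDeriv_tensorFun_apply {A B : W → ℂ} {x : W} (hA : AnalyticAt ℂ A x)
    (hB : AnalyticAt ℂ B x) (t : ℂ) {m : ℕ} {S : Finset (Fin n)} (hS : S.card = m) :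
    iteratedFDeriv ℂ m (tensorFun A B) (x, x)
        (fun i => (t • dir W (S.orderEmbOfFin hS i), dir W (S.orderEmbOfFin hS i))) =
      ∑ J ∈ S.powerset, t ^ J.card * (pdSet W J A x * pdSet W (S \ J) B x) := by
  rw [(iteratedFDeriv_eventuallyEq_iteratedLineDeriv (analyticAt_tensorFun hA hB) _).eq_of_nhds,
    ofFn_comp_orderEmbOfFin fun i => (t • dir W i, dir W i),
    (iteratedLineDeriv_tensorFun hA hB t S).eq_of_nhds]
  rfl

end PartialDerivatives

/-! ### Elementary symmetric sums from powers of partial sums -/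

section PartialSums

lemma choose_mul_choose_sub (N j s : ℕ) :
    N.choose j * (N - j).choose s = N.choose s * (N - s).choose j := by
  rcases le_or_gt (j + s) N with h | h
  · have hmul := Nat.choose_mul (n := N) (k := N - j) (s := s) (by omega)
    rwa [Nat.choose_symm (by omega), show N - j - s = N - s - j by omega,
      Nat.choose_symm (by omega)] at hmul
  · rcases le_or_gt s N with hs | hs
    · rw [Nat.choose_eq_zero_of_lt (show N - s < j by omega), mul_zero, mul_eq_zero]
      exact (le_or_gt j N).elim (fun hj => .inr (Nat.choose_eq_zero_of_lt (by omega)))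
        fun hj => .inl (Nat.choose_eq_zero_of_lt hj)
    · rw [Nat.choose_eq_zero_of_lt hs, Nat.choose_eq_zero_of_lt (show N - j < s by omega),
        mul_zero, zero_mul]

-- Up to the factor `(D + q).choose q` this is the `D`-th finite difference of `y ↦ y ^ k` at `p`.
lemma alternating_sum_choose_mul_pow {R : Type*} [CommRing R] (q : ℕ) {D k : ℕ} (hk : k ≤ D)
    (p : R) :
    ∑ j ∈ Finset.range (D + q + 1),
        (D + q).choose j * ((-1) ^ (D - j) * (D + q - j).choose q * (p + j) ^ k) =
      if k = D then ((D + q).choose D * D.factorial : R) else 0 := by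
  have hterm (j : ℕ) : (D + q).choose j * ((-1) ^ (D - j) * (D + q - j).choose q * (p + j) ^ k) =
      ((D + q).choose D : R) * (((-1 : ℤ) ^ (D - j) * D.choose j) • (p + j • 1) ^ k) := by
    have hchoose := choose_mul_choose_sub (D + q) j q
    rw [Nat.add_sub_cancel, ← Nat.choose_symm_add] at hchoose
    have hcast := congrArg (Nat.cast (R := R)) hchoose
    push_cast at hcast
    simp only [zsmul_eq_mul, nsmul_eq_mul, mul_one, Int.cast_mul, Int.cast_pow, Int.cast_neg,
      Int.cast_one, Int.cast_natCast]
    linear_combination (-1) ^ (D - j) * (p + j) ^ k * hcast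
  have hrange : Finset.range (D + 1) ⊆ Finset.range (D + q + 1) :=
    Finset.range_subset_range.mpr (by omega)
  simp_rw [hterm]
  rw [← Finset.mul_sum, ← Finset.sum_subset hrange fun j _ hj => by
      rw [Nat.choose_eq_zero_of_lt (by simpa using hj), Nat.cast_zero, mul_zero, zero_smul],
    ← fwdDiff_iter_eq_sum_shift (1 : R) (fun y => y ^ k) D p]
  split_ifs with h
  · rw [h, fwdDiff_iter_eq_factorial]
    rfl
  · rw [fwdDiff_iter_pow_eq_zero_of_lt (by omega)]
    simp

lemma sum_superset_apply_card {ι R : Type*} [Fintype ι] [DecidableEq ι] [AddCommMonoid R]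
    (S : Finset ι) (φ : ℕ → R) :
    ∑ K : Finset ι with S ⊆ K, φ K.card =
      ∑ j ∈ Finset.range (Sᶜ.card + 1), Sᶜ.card.choose j • φ (S.card + j) := by
  have hdisjoint {J : Finset ι} (hJ : J ∈ Sᶜ.powerset) : Disjoint S J :=
    (Finset.subset_compl_iff_disjoint_left).mp (Finset.mem_powerset.mp hJ)
  have himage : ({K | S ⊆ K} : Finset (Finset ι)) = Sᶜ.powerset.image (S ∪ ·) := by
    rw [Finset.compl_eq_univ_sdiff, ← Finset.Icc_eq_image_powerset (Finset.subset_univ S)]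
    ext K
    simp
  rw [himage, Finset.sum_image fun J hJ J' hJ' h => ?_,
    ← Finset.sum_powerset_apply_card fun j => φ (S.card + j)]
  · exact Finset.sum_congr rfl fun J hJ => by rw [Finset.card_union_of_disjoint (hdisjoint hJ)]
  · rw [← Finset.union_sdiff_cancel_left (hdisjoint hJ), h,
      Finset.union_sdiff_cancel_left (hdisjoint hJ')]

variable {ι R E F : Type*} [Fintype ι] [CommRing R] [AddCommGroup E] [Module R E]
  [AddCommGroup F] [Module R F]

lemma sum_smul_map_sum_finset [DecidableEq ι] {κ : Type*} [Fintype κ] [DecidableEq κ]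
    (T : MultilinearMap R (fun _ : κ => E) F) (φ : Finset ι → R) (ξ : ι → E) :
    ∑ K, φ K • T (fun _ => ∑ i ∈ K, ξ i) =
      ∑ r : κ → ι, (∑ K with Finset.univ.image r ⊆ K, φ K) • T fun a => ξ (r a) := by
  have hexpand (K : Finset ι) : T (fun _ => ∑ i ∈ K, ξ i) =
      ∑ r : κ → ι, if Finset.univ.image r ⊆ K then T (fun a => ξ (r a)) else 0 := by
    rw [T.map_sum_finset (fun _ i => ξ i) fun _ => K, ← Finset.sum_filter]
    refine Finset.sum_congr ?_ fun _ _ => rfl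
    ext r
    simp [Fintype.mem_piFinset, Finset.image_subset_iff]
  simp_rw [hexpand, Finset.smul_sum, smul_ite, smul_zero]
  rw [Finset.sum_comm]
  exact Finset.sum_congr rfl fun r _ => by rw [← Finset.sum_filter, Finset.sum_smul]

lemma alternating_sum_superset_image [DecidableEq ι] {m k : ℕ} (hmk : m + k ≤ Fintype.card ι)
    (r : Fin m → ι) :
    ∑ K : Finset ι with Finset.univ.image r ⊆ K, ((-1) ^ (m + k - K.card) *
        (Fintype.card ι - K.card).choose (Fintype.card ι - (m + k)) * K.card ^ k : R) =
      if Function.Injective r then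
        ((Fintype.card ι - m).choose k * k.factorial : R) else 0 := by
  obtain ⟨q, hq⟩ := Nat.exists_eq_add_of_le hmk
  have himage : (Finset.univ.image r).card ≤ m := by
    simpa using Finset.card_image_le (s := Finset.univ) (f := r)
  have hinjective : k = m + k - (Finset.univ.image r).card ↔ Function.Injective r := by
    rw [← Set.injOn_univ, ← Finset.coe_univ, ← Finset.card_image_iff, Finset.card_fin]
    omega
  rw [sum_superset_apply_card _ fun t => ((-1) ^ (m + k - t) *
      (Fintype.card ι - t).choose (Fintype.card ι - (m + k)) * t ^ k : R), Finset.card_compl]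
  simp_rw [← hinjective]
  generalize (Finset.univ.image r).card = p at himage ⊢
  obtain ⟨D, hD⟩ := Nat.exists_eq_add_of_le (show p ≤ m + k by omega)
  rw [hq, hD, show p + D + q - p = D + q by omega, show p + D - p = D by omega]
  simp only [nsmul_eq_mul, Nat.cast_add, show p + D + q - (p + D) = q by omega,
    fun j => show p + D - (p + j) = D - j by omega,
    fun j => show p + D + q - (p + j) = D + q - j by omega]
  rw [alternating_sum_choose_mul_pow q (by omega) (p : R)]
  split_ifs with h
  · rw [h, show p + D + q - m = D + q by omega]
  · rfl

lemma alternating_sum_multilinear_partialSums [LinearOrder ι] {m k : ℕ}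
    (hmk : m + k ≤ Fintype.card ι) (T : MultilinearMap R (fun _ : Fin m => E) F)
    (hT : ∀ (v : Fin m → E) (π : Equiv.Perm (Fin m)), T (v ∘ π) = T v) (ξ : ι → E) :
    ∑ j ∈ Finset.range (m + k + 1),
        ((-1) ^ (m + k - j) * (Fintype.card ι - j).choose (Fintype.card ι - (m + k)) * j ^ k : R) •
          ∑ K ∈ Finset.powersetCard j (Finset.univ : Finset ι), T (fun _ => ∑ i ∈ K, ξ i) =
      ((Fintype.card ι - m).choose k * k.factorial * m.factorial : R) •
        ∑ S : {S : Finset ι // S.card = m}, T fun a => ξ (S.1.orderEmbOfFin S.2 a) := by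
  have hrange : Finset.range (m + k + 1) ⊆ Finset.range (Fintype.card ι + 1) :=
    Finset.range_subset_range.mpr (by omega)
  have hvanish : ∀ j ∈ Finset.range (Fintype.card ι + 1), j ∉ Finset.range (m + k + 1) →
      (Fintype.card ι - j).choose (Fintype.card ι - (m + k)) = 0 := fun j hj hj' =>
    Nat.choose_eq_zero_of_lt (by simp only [Finset.mem_range] at hj hj'; omega)
  rw [Finset.sum_subset hrange fun j hj hj' => by rw [hvanish j hj hj']; simp]
  have hcollect := Finset.sum_powerset (Finset.univ : Finset ι) fun K =>
    ((-1) ^ (m + k - K.card) * (Fintype.card ι - K.card).choose (Fintype.card ι - (m + k)) *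
      K.card ^ k : R) • T fun _ => ∑ i ∈ K, ξ i
  rw [Finset.powerset_univ, Finset.card_univ, sum_smul_map_sum_finset] at hcollect
  simp_rw [alternating_sum_superset_image hmk, ite_smul, zero_smul] at hcollect
  rw [← Finset.sum_filter, ← Finset.smul_sum, sum_injective_eq_factorial_nsmul_sum
    (G := fun r : Fin m → ι => T fun a => ξ (r a)) fun r π => hT (fun a => ξ (r a)) π] at hcollect
  rw [mul_smul, Nat.cast_smul_eq_nsmul, hcollect]
  refine Finset.sum_congr rfl fun j _ => ?_
  rw [Finset.smul_sum]
  exact Finset.sum_congr rfl fun K hK => by rw [(Finset.mem_powersetCard.mp hK).2]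

end PartialSums

/-! ### Expansion of the difference operators -/

section DifferenceExpansion

variable {n : ℕ} {W : Submodule ℂ (EuclideanSpace ℂ (Fin n))} {τ c u : ℂ} {x : W}

lemma diffBar_eq_clm (x : W) (i j : Fin n) :
    diffBar W x i j = ((EuclideanSpace.proj i - EuclideanSpace.proj j :
      EuclideanSpace ℂ (Fin n) →L[ℂ] ℂ).comp W.subtypeL) x := by
  simp [diffBar, pairBar]

lemma analyticAt_Delta (hτ : 0 < τ.im) (x : W) : AnalyticAt ℂ (Delta W τ) x := by
  refine Finset.analyticAt_fun_prod _ fun i _ => Finset.analyticAt_fun_prod _ fun j _ => ?_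
  simp_rw [diffBar_eq_clm]
  exact ((differentiable_theta hτ).analyticAt _).fun_comp (ContinuousLinearMap.analyticAt _ x)

lemma Delta_ne_zero (hx : ∀ i j : Fin n, i ≠ j → theta τ (diffBar W x i j) ≠ 0) :
    Delta W τ x ≠ 0 :=
  Finset.prod_ne_zero_iff.mpr fun i _ => Finset.prod_ne_zero_iff.mpr fun j hj =>
    hx i j (Finset.mem_Ioi.mp hj).ne

lemma eventually_theta_mul_Delta_ne_zero (hτ : 0 < τ.im) (hu : theta τ u ≠ 0)
    (hx : Delta W τ x ≠ 0) {t : ℂ → ℂ} {y : ℂ → W} (ht : ContinuousAt t 0) (ht0 : t 0 = u)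
    (hy : ContinuousAt y 0) (hy0 : y 0 = x) :
    ∀ᶠ h in 𝓝 0, theta τ (t h) * Delta W τ (y h) ≠ 0 := by
  have hcont : ContinuousAt (fun h => theta τ (t h) * Delta W τ (y h)) 0 :=
    ((differentiable_theta hτ).continuous.continuousAt.comp ht).mul
      (ContinuousAt.comp (g := Delta W τ) (analyticAt_Delta hτ _).continuousAt hy)
  exact hcont.eventually_ne (by rw [ht0, hy0]; exact mul_ne_zero hu hx)

-- The base point may move with the step, as it does in the composition `Ṁ_1 ∘ Ṁ_1`.
lemma eventually_Mdot_eq_sum [NeZero n] (hW : weightSpace n ≤ W) (hτ : 0 < τ.im) (c : ℂ)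
    (hu : theta τ u ≠ 0) (hx : Delta W τ x ≠ 0) {y : ℂ → W} (hy : ContinuousAt y 0)
    (hy0 : y 0 = x) (d : ℕ) :
    ∀ᶠ h in 𝓝 0, ∀ f : W → ℂ, Mdot W τ c h u d f (y h) =
      ∑ K ∈ Finset.powersetCard d (Finset.univ : Finset (Fin n)),
        Delta W τ (y h - (c / n * h) • ∑ i ∈ K, dir W i) / Delta W τ (y h) *
          f (y h + h • ∑ i ∈ K, dir W i) := by
  have hbase : ∀ᶠ h in 𝓝 0, theta τ u * Delta W τ (y h) ≠ 0 :=
    eventually_theta_mul_Delta_ne_zero hτ hu hx continuousAt_const rfl hy hy0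
  have hpath : ∀ᶠ h in 𝓝 0, ∀ (k : Fin d → Fin n) (r : Fin d),
      theta τ (u - (r : ℕ) * h) * Delta W τ (pathPoint h (y h) k r) ≠ 0 := by
    refine eventually_all.mpr fun k => eventually_all.mpr fun r => ?_
    refine eventually_theta_mul_Delta_ne_zero hτ hu hx (by fun_prop) (by simp) ?_
      (by simp [pathPoint, hy0])
    exact hy.add (by fun_prop)
  have hshift : ∀ᶠ h in 𝓝 0, theta τ (u + d * (c / n * h)) * Delta W τ (y h) ≠ 0 :=
    eventually_theta_mul_Delta_ne_zero hτ hu hx (by fun_prop) (by simp) hy hy0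
  filter_upwards [hbase, hpath, hshift] with h hbase hpath hshift f
  exact Mdot_eq_sum hW hτ hu (right_ne_zero_of_mul hbase) hpath (left_ne_zero_of_mul hshift) f

lemma tensorFun_add_smul_sum (A B : W → ℂ) (x : W) (t h : ℂ) (K : Finset (Fin n)) :
    tensorFun A B ((x, x) + h • ∑ i ∈ K, (t • dir W i, dir W i)) =
      A (x + (t * h) • ∑ i ∈ K, dir W i) * B (x + h • ∑ i ∈ K, dir W i) := by
  have hsum : ∑ i ∈ K, (t • dir W i, dir W i) = (t • ∑ i ∈ K, dir W i, ∑ i ∈ K, dir W i) :=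
    Prod.ext (by rw [Prod.fst_sum, Finset.smul_sum]) (by rw [Prod.snd_sum])
  rw [hsum, mul_comm t h, mul_smul]
  rfl

lemma analyticAt_tensorFun_line {A B : W → ℂ} (hA : AnalyticAt ℂ A x) (hB : AnalyticAt ℂ B x)
    (ξ : W × W) : AnalyticAt ℂ (fun h : ℂ => tensorFun A B ((x, x) + h • ξ)) 0 := by
  have hline : AnalyticAt ℂ (fun h : ℂ => (x, x) + h • ξ) 0 :=
    analyticAt_const.add (analyticAt_id.smul analyticAt_const)
  refine AnalyticAt.fun_comp ?_ hline
  rw [zero_smul, add_zero]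
  exact analyticAt_tensorFun hA hB

lemma Mdot_eventuallyEq [NeZero n] (hW : weightSpace n ≤ W) (hτ : 0 < τ.im) (c : ℂ)
    (hu : theta τ u ≠ 0) (hx : Delta W τ x ≠ 0) (f : W → ℂ) (d : ℕ) :
    (fun h => Mdot W τ c h u d f x) =ᶠ[𝓝 0] fun h =>
      ∑ K ∈ Finset.powersetCard d (Finset.univ : Finset (Fin n)), (Delta W τ x)⁻¹ *
        tensorFun (Delta W τ) f ((x, x) + h • ∑ i ∈ K, (-(c / n) • dir W i, dir W i)) := by
  filter_upwards [eventually_Mdot_eq_sum hW hτ c hu hx (y := fun _ => x) continuousAt_const rfl d]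
    with h hh
  rw [hh]
  refine Finset.sum_congr rfl fun K _ => ?_
  rw [tensorFun_add_smul_sum, neg_mul, neg_smul, ← sub_eq_add_neg]
  ring

lemma analyticAt_Mdot [NeZero n] (hW : weightSpace n ≤ W) (hτ : 0 < τ.im) (c : ℂ)
    (hu : theta τ u ≠ 0) (hx : Delta W τ x ≠ 0) {f : W → ℂ} (hf : AnalyticAt ℂ f x) (d : ℕ) :
    AnalyticAt ℂ (fun h => Mdot W τ c h u d f x) 0 :=
  (Finset.analyticAt_fun_sum _ fun _ _ => analyticAt_const.mul
    (analyticAt_tensorFun_line (analyticAt_Delta hτ x) hf _)).congr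
    (Mdot_eventuallyEq hW hτ c hu hx f d).symm

lemma iteratedDeriv_Mdot [NeZero n] (hW : weightSpace n ≤ W) (hτ : 0 < τ.im) (c : ℂ)
    (hu : theta τ u ≠ 0) (hx : Delta W τ x ≠ 0) {f : W → ℂ} (hf : AnalyticAt ℂ f x) (d m : ℕ) :
    iteratedDeriv m (fun h => Mdot W τ c h u d f x) 0 = (Delta W τ x)⁻¹ *
      ∑ K ∈ Finset.powersetCard d (Finset.univ : Finset (Fin n)),
        iteratedFDeriv ℂ m (tensorFun (Delta W τ) f) (x, x)
          (fun _ => ∑ i ∈ K, (-(c / n) • dir W i, dir W i)) := by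
  have hΔ := analyticAt_Delta hτ x
  rw [(Mdot_eventuallyEq hW hτ c hu hx f d).iteratedDeriv_eq, iteratedDeriv_fun_sum,
    Finset.mul_sum]
  · refine Finset.sum_congr rfl fun K _ => ?_
    rw [iteratedDeriv_const_mul_field, iteratedDeriv_comp_line (analyticAt_tensorFun hΔ hf)]
  · exact fun K _ => (analyticAt_const.mul (analyticAt_tensorFun_line hΔ hf _)).contDiffAt

lemma neg_div_pow_mul_neg_div_pow {K : Type*} [Field K] {a b : K} (ha : a ≠ 0) (hb : b ≠ 0)
    (m : ℕ) : (-(a / b)) ^ m * (-(b / a)) ^ m = 1 := by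
  rw [← mul_pow, neg_mul_neg, div_mul_div_cancel₀ hb, div_self ha, one_pow]

lemma Dop_eq_sum_iteratedFDeriv [NeZero n] (hτ : 0 < τ.im) (hc : c ≠ 0) {f : W → ℂ}
    (hf : AnalyticAt ℂ f x) (m : ℕ) :
    Dop W τ c m f x = (-(n / c)) ^ m * (Delta W τ x)⁻¹ *
      ∑ S : {S : Finset (Fin n) // S.card = m},
        iteratedFDeriv ℂ m (tensorFun (Delta W τ) f) (x, x)
          (fun i => (-(c / n) • dir W (S.1.orderEmbOfFin S.2 i),
            dir W (S.1.orderEmbOfFin S.2 i))) := by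
  have hn : (n : ℂ) ≠ 0 := NeZero.ne _
  rw [Dop, Finset.sum_subtype (p := fun S : Finset (Fin n) => S.card = m) _ (by simp),
    Finset.mul_sum]
  refine Finset.sum_congr rfl fun S _ => ?_
  rw [iteratedFDeriv_tensorFun_apply (analyticAt_Delta hτ x) hf, Finset.mul_sum]
  refine Finset.sum_congr rfl fun J hJ => ?_
  have hpow : (-(n / c) : ℂ) ^ m = (-(n / c)) ^ (S.1 \ J).card * (-(n / c)) ^ J.card := by
    rw [← pow_add, Finset.card_sdiff_add_card_eq_card (Finset.mem_powerset.mp hJ), S.2]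
  rw [hpow]
  linear_combination (-(pdSet W J (Delta W τ) x * (Delta W τ x)⁻¹ *
    (-(n / c)) ^ (S.1 \ J).card * pdSet W (S.1 \ J) f x)) *
      neg_div_pow_mul_neg_div_pow hn hc J.card

lemma Dop_eq_alternating_sum_iteratedDeriv [NeZero n] (hW : weightSpace n ≤ W) (hτ : 0 < τ.im)
    (hc : c ≠ 0) (hu : theta τ u ≠ 0) (hx : Delta W τ x ≠ 0) {f : W → ℂ} (hf : AnalyticAt ℂ f x)
    {m k : ℕ} (hmk : m + k ≤ n) :
    Dop W τ c m f x = (-(n / c)) ^ m / ((n - m).choose k * k.factorial * m.factorial : ℂ) *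
      ∑ j ∈ Finset.range (m + k + 1), (-1) ^ (m + k - j) * ((n - j).choose (n - (m + k)) : ℂ) *
        j ^ k * iteratedDeriv m (fun h => Mdot W τ c h u j f x) 0 := by
  have hanalytic := analyticAt_tensorFun (q := (x, x)) (analyticAt_Delta hτ x) hf
  have hsymm := alternating_sum_multilinear_partialSums (m := m) (k := k) (by simpa using hmk)
    (iteratedFDeriv ℂ m (tensorFun (Delta W τ) f) (x, x)).toMultilinearMap
    hanalytic.contDiffAt.iteratedFDeriv_comp_perm
    fun i : Fin n => (-(c / n) • dir W i, dir W i)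
  simp only [Fintype.card_fin, smul_eq_mul, ContinuousMultilinearMap.coe_coe] at hsymm
  have hchoose : ((n - m).choose k : ℂ) ≠ 0 :=
    Nat.cast_ne_zero.mpr (Nat.choose_pos (by omega)).ne'
  have hfactorial (r : ℕ) : (r.factorial : ℂ) ≠ 0 := Nat.cast_ne_zero.mpr r.factorial_ne_zero
  have hne := mul_ne_zero (mul_ne_zero hchoose (hfactorial k)) (hfactorial m)
  rw [Dop_eq_sum_iteratedFDeriv hτ hc hf, eq_div_of_mul_eq hne ((mul_comm _ _).trans hsymm.symm),
    mul_assoc, div_mul_eq_mul_div, mul_div_assoc, ← mul_div_assoc _ _ (_ * _ * _), Finset.mul_sum]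
  congr 2
  refine Finset.sum_congr rfl fun j _ => ?_
  rw [iteratedDeriv_Mdot hW hτ c hu hx hf]
  ring

theorem Dop_eq_sum_iteratedDeriv [NeZero n] (hW : weightSpace n ≤ W) (hτ : 0 < τ.im)
    (hc : c ≠ 0) (hu : theta τ u ≠ 0) (hx : Delta W τ x ≠ 0) {f : W → ℂ}
    (hf : AnalyticAt ℂ f x) {d k : ℕ} (hk : k ≤ d) (hd : d ≤ n) :
    Dop W τ c (d - k) f x = (-(n / c)) ^ d / ((n - d + k).choose k : ℂ) *
      ∑ j ∈ Finset.range (d + 1), (-1) ^ (d - j) * ((n - j).choose (n - d) : ℂ) *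
        ((-(c * j / n)) ^ k / (k.factorial : ℂ)) *
        (iteratedDeriv (d - k) (fun h => Mdot W τ c h u j f x) 0 / ((d - k).factorial : ℂ)) := by
  obtain ⟨m, rfl⟩ := Nat.exists_eq_add_of_le' hk
  have hterm (j : ℕ) :
      (-1) ^ (m + k - j) * ((n - j).choose (n - (m + k)) : ℂ) *
        ((-(c * j / n)) ^ k / (k.factorial : ℂ)) *
        (iteratedDeriv m (fun h => Mdot W τ c h u j f x) 0 / (m.factorial : ℂ)) =
      (-(c / n)) ^ k / (k.factorial * m.factorial) *
        ((-1) ^ (m + k - j) * ((n - j).choose (n - (m + k)) : ℂ) * j ^ k *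
          iteratedDeriv m (fun h => Mdot W τ c h u j f x) 0) := by
    rw [show -(c * j / n) = -(c / n) * j by ring, mul_pow]
    ring
  have hinv := neg_div_pow_mul_neg_div_pow (NeZero.ne (n : ℂ)) hc k
  simp_rw [Nat.add_sub_cancel, hterm]
  rw [Dop_eq_alternating_sum_iteratedDeriv hW hτ hc hu hx hf hd, ← Finset.mul_sum, ← mul_assoc,
    show n - (m + k) + k = n - m by omega, pow_add]
  congr 1
  linear_combination (-((-(n / c)) ^ m /
    ((n - m).choose k * k.factorial * m.factorial : ℂ))) * hinv

end DifferenceExpansion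

/-! ### Second-order jets -/

section TwoJets

variable {F G : ℂ → ℂ} {a b c a' b' c' : ℂ}

/-- `F` is analytic at `0` and has the second-order jet `(F 0, F' 0, F'' 0) = (a, b, c)` there.
Limits of second-order difference quotients are read off from such jets. -/
structure HasTwoJet (F : ℂ → ℂ) (a b c : ℂ) : Prop where
  analyticAt : AnalyticAt ℂ F 0
  apply_zero : F 0 = a
  deriv_zero : deriv F 0 = b
  deriv_deriv_zero : deriv (deriv F) 0 = c

namespace HasTwoJet

lemma congr (hF : HasTwoJet F a b c) (h : G =ᶠ[𝓝 0] F) : HasTwoJet G a b c :=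
  ⟨hF.analyticAt.congr h.symm, h.self_of_nhds.trans hF.apply_zero,
    h.deriv_eq.trans hF.deriv_zero, h.deriv.deriv_eq.trans hF.deriv_deriv_zero⟩

lemma of_eq (hF : HasTwoJet F a b c) (ha : a = a') (hb : b = b') (hc : c = c') :
    HasTwoJet F a' b' c' := by
  subst ha hb hc
  exact hF

lemma const (a : ℂ) : HasTwoJet (fun _ => a) a 0 0 :=
  ⟨analyticAt_const, rfl, by simp, by simp⟩

lemma add (hF : HasTwoJet F a b c) (hG : HasTwoJet G a' b' c') :
    HasTwoJet (fun h => F h + G h) (a + a') (b + b') (c + c') := by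
  obtain ⟨hF, rfl, rfl, rfl⟩ := hF
  obtain ⟨hG, rfl, rfl, rfl⟩ := hG
  have hderiv : deriv (fun h => F h + G h) =ᶠ[𝓝 0] fun h => deriv F h + deriv G h := by
    filter_upwards [hF.eventually_analyticAt, hG.eventually_analyticAt] with h hf hg
    exact deriv_fun_add hf.differentiableAt hg.differentiableAt
  refine ⟨hF.add hG, rfl, hderiv.self_of_nhds, ?_⟩
  rw [hderiv.deriv_eq, deriv_fun_add hF.deriv.differentiableAt hG.deriv.differentiableAt]

lemma mul (hF : HasTwoJet F a b c) (hG : HasTwoJet G a' b' c') :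
    HasTwoJet (fun h => F h * G h) (a * a') (b * a' + a * b')
      (c * a' + 2 * b * b' + a * c') := by
  obtain ⟨hF, rfl, rfl, rfl⟩ := hF
  obtain ⟨hG, rfl, rfl, rfl⟩ := hG
  have hderiv : deriv (fun h => F h * G h) =ᶠ[𝓝 0]
      fun h => deriv F h * G h + F h * deriv G h := by
    filter_upwards [hF.eventually_analyticAt, hG.eventually_analyticAt] with h hf hg
    exact deriv_fun_mul hf.differentiableAt hg.differentiableAt
  refine ⟨hF.mul hG, rfl, hderiv.self_of_nhds, ?_⟩
  rw [hderiv.deriv_eq, deriv_fun_add (hF.deriv.fun_mul hG).differentiableAt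
    (hF.fun_mul hG.deriv).differentiableAt,
    deriv_fun_mul hF.deriv.differentiableAt hG.differentiableAt,
    deriv_fun_mul hF.differentiableAt hG.deriv.differentiableAt]
  ring

lemma const_mul (k : ℂ) (hF : HasTwoJet F a b c) :
    HasTwoJet (fun h => k * F h) (k * a) (k * b) (k * c) :=
  ((const k).mul hF).of_eq rfl (by ring) (by ring)

lemma sub (hF : HasTwoJet F a b c) (hG : HasTwoJet G a' b' c') :
    HasTwoJet (fun h => F h - G h) (a - a') (b - b') (c - c') := by
  simpa only [neg_one_mul, ← sub_eq_add_neg] using hF.add (hG.const_mul (-1))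

lemma sum {ι : Type*} (s : Finset ι) {F : ι → ℂ → ℂ} {a b c : ι → ℂ}
    (hF : ∀ i ∈ s, HasTwoJet (F i) (a i) (b i) (c i)) :
    HasTwoJet (fun h => ∑ i ∈ s, F i h) (∑ i ∈ s, a i) (∑ i ∈ s, b i) (∑ i ∈ s, c i) := by
  classical
  induction s using Finset.induction_on with
  | empty => exact const 0
  | insert i s hi ih =>
    simp only [Finset.sum_insert hi]
    exact (hF i (Finset.mem_insert_self i s)).add
      (ih fun j hj => hF j (Finset.mem_insert_of_mem hj))

lemma exp (hF : HasTwoJet F a b c) :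
    HasTwoJet (fun h => cexp (F h)) (cexp a) (cexp a * b) (cexp a * (c + b ^ 2)) := by
  obtain ⟨hF, rfl, rfl, rfl⟩ := hF
  have hderiv : deriv (fun h => cexp (F h)) =ᶠ[𝓝 0]
      fun h => cexp (F h) * deriv F h := by
    filter_upwards [hF.eventually_analyticAt] with h hf
    exact hf.differentiableAt.hasDerivAt.cexp.deriv
  refine ⟨hF.cexp, rfl, hderiv.self_of_nhds, ?_⟩
  rw [hderiv.deriv_eq, deriv_fun_mul hF.differentiableAt.cexp hF.deriv.differentiableAt,
    hderiv.self_of_nhds]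
  ring

lemma tendsto_div_sq (hF : HasTwoJet F 0 0 c) :
    Tendsto (fun h => F h / h ^ 2) (𝓝[≠] 0) (𝓝 (c / 2)) := by
  obtain ⟨R, hR, hFR⟩ := hF.analyticAt.exists_eq_sum_add_pow_mul 3
  have hcont : ContinuousAt (fun h => c / 2 + h * R h) 0 :=
    continuousAt_const.add (continuousAt_id.mul hR.continuousAt)
  have hlim : Tendsto (fun h => c / 2 + h * R h) (𝓝 0) (𝓝 (c / 2)) := by
    simpa only [zero_mul, add_zero] using hcont.tendsto
  refine (hlim.mono_left nhdsWithin_le_nhds).congr' ?_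
  filter_upwards [self_mem_nhdsWithin] with h hh
  have hh : h ≠ 0 := hh
  have htwo : iteratedDeriv 2 F 0 = c := by
    rw [iteratedDeriv_succ, iteratedDeriv_one, hF.deriv_deriv_zero]
  rw [hFR h]
  simp only [Finset.sum_range_succ, Finset.sum_range_zero, iteratedDeriv_zero, iteratedDeriv_one,
    hF.apply_zero, hF.deriv_zero, htwo, smul_eq_mul, mul_zero, zero_add, Nat.factorial]
  field_simp
  push_cast
  ring

end HasTwoJet

variable {E : Type*} [NormedAddCommGroup E] [NormedSpace ℂ E] {l f : E → ℂ} {p : E}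

lemma hasTwoJet_line (hf : AnalyticAt ℂ f p) (ξ : E) :
    HasTwoJet (fun h => f (p + h • ξ)) (f p) (fderiv ℂ f p ξ)
      (fderiv ℂ (fderiv ℂ f) p ξ ξ) where
  analyticAt := AnalyticAt.fun_comp (by simpa using hf)
    (analyticAt_const.add (analyticAt_id.smul analyticAt_const))
  apply_zero := by simp
  deriv_zero := by
    rw [← iteratedDeriv_one, iteratedDeriv_comp_line hf, iteratedFDeriv_one_apply]
  deriv_deriv_zero := by
    rw [← iteratedDeriv_one (f := fun h : ℂ => f (p + h • ξ)), ← iteratedDeriv_succ,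
      iteratedDeriv_comp_line hf, iteratedFDeriv_two_apply]

lemma HasTwoJet.exp_mul_line (hF : HasTwoJet F 0 b c) (hf : AnalyticAt ℂ f p) (ξ : E) :
    HasTwoJet (fun h => cexp (F h) * f (p + h • ξ)) (f p) (b * f p + fderiv ℂ f p ξ)
      ((c + b ^ 2) * f p + 2 * b * fderiv ℂ f p ξ + fderiv ℂ (fderiv ℂ f) p ξ ξ) :=
  (hF.exp.mul (hasTwoJet_line hf ξ)).of_eq (by simp) (by simp) (by simp)

/-- `log (Δ(p + h(w - g v)) / Δ(p + h w))` for `l = log Δ`: the logarithm of the coefficient with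
which the shift by `h v` enters the difference operators at the point `p + h w`. -/
def logRatio (l : E → ℂ) (p : E) (g : ℂ) (w v : E) (h : ℂ) : ℂ :=
  l (p + h • (w - g • v)) - l (p + h • w)

lemma fderiv_fderiv_comm (hl : AnalyticAt ℂ l p) (v w : E) :
    fderiv ℂ (fderiv ℂ l) p v w = fderiv ℂ (fderiv ℂ l) p w v :=
  (hl.contDiffAt (n := ⊤)).isSymmSndFDerivAt (by simp) v w

lemma hasTwoJet_logRatio (hl : AnalyticAt ℂ l p) (g : ℂ) (w v : E) :
    HasTwoJet (logRatio l p g w v) 0 (-(g * fderiv ℂ l p v))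
      (g ^ 2 * fderiv ℂ (fderiv ℂ l) p v v - 2 * g * fderiv ℂ (fderiv ℂ l) p v w) := by
  refine ((hasTwoJet_line hl (w - g • v)).sub (hasTwoJet_line hl w)).of_eq (by simp) (by simp) ?_
  simp only [map_sub, map_smul, sub_apply, smul_apply, smul_eq_mul, fderiv_fderiv_comm hl w v]
  ring

end TwoJets

/-! ### The logarithm of `Δ` -/

section LogDelta

variable {n : ℕ} {W : Submodule ℂ (EuclideanSpace ℂ (Fin n))} {τ : ℂ} {x : W} {l : W → ℂ}

lemma exists_isLogDelta (hτ : 0 < τ.im) (hx : Delta W τ x ≠ 0) :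
    ∃ l : W → ℂ, IsLogDelta W τ l x := by
  have hΔ := analyticAt_Delta hτ x
  refine ⟨fun y => Complex.log (Delta W τ y / Delta W τ x) + Complex.log (Delta W τ x), ?_, ?_⟩
  · exact ((hΔ.div analyticAt_const hx).clog (by simp [div_self hx])).add analyticAt_const
  · filter_upwards [hΔ.continuousAt.eventually_ne hx] with y hy
    rw [Complex.exp_add, Complex.exp_log (div_ne_zero hy hx), Complex.exp_log hx,
      div_mul_cancel₀ _ hx]

lemma eventually_isLogDelta (hl : IsLogDelta W τ l x) : ∀ᶠ y in 𝓝 x, IsLogDelta W τ l y := by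
  filter_upwards [hl.1.eventually_analyticAt, hl.2.eventually_nhds] with y hy hexp
  exact ⟨hy, hexp⟩

lemma tendsto_add_smul_nhds_zero (x v : W) : Tendsto (fun h : ℂ => x + h • v) (𝓝 0) (𝓝 x) := by
  have hcont : Continuous fun h : ℂ => x + h • v := by fun_prop
  simpa using hcont.tendsto 0

lemma diffBar_add_smul (x v : W) (h : ℂ) (i j : Fin n) :
    diffBar W (x + h • v) i j = diffBar W x i j + h * diffBar W v i j := by
  simp only [diffBar, pairBar_add_smul]
  ring

lemma hasDerivAt_diffBar_line (x v : W) (i j : Fin n) :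
    HasDerivAt (fun h : ℂ => diffBar W (x + h • v) i j) (diffBar W v i j) 0 := by
  simp_rw [diffBar_add_smul]
  simpa using ((hasDerivAt_id (0 : ℂ)).mul_const (diffBar W v i j)).const_add (diffBar W x i j)

lemma logDeriv_Delta_line (hτ : 0 < τ.im)
    (hx : ∀ i j : Fin n, i ≠ j → theta τ (diffBar W x i j) ≠ 0) (v : W) :
    logDeriv (fun h : ℂ => Delta W τ (x + h • v)) 0 =
      ∑ i : Fin n, ∑ j ∈ Finset.Ioi i, diffBar W v i j * logDeriv (theta τ) (diffBar W x i j) := by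
  have hθ (i j : Fin n) : HasDerivAt (fun h : ℂ => theta τ (diffBar W (x + h • v) i j))
      (deriv (theta τ) (diffBar W x i j) * diffBar W v i j) 0 :=
    HasDerivAt.comp (h₂ := theta τ) 0
      (by simpa using (differentiable_theta hτ _).hasDerivAt) (hasDerivAt_diffBar_line x v i j)
  have hne {i j : Fin n} (hj : j ∈ Finset.Ioi i) :
      theta τ (diffBar W (x + (0 : ℂ) • v) i j) ≠ 0 := by
    simpa using hx i j (Finset.mem_Ioi.mp hj).ne
  unfold Delta
  rw [logDeriv_prod (f := fun i (h : ℂ) =>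
      ∏ j ∈ Finset.Ioi i, theta τ (diffBar W (x + h • v) i j))
    (fun i _ => Finset.prod_ne_zero_iff.mpr fun j hj => hne hj)
    fun i _ => DifferentiableAt.fun_finsetProd fun j _ => (hθ i j).differentiableAt]
  refine Finset.sum_congr rfl fun i _ => ?_
  rw [logDeriv_prod (f := fun j (h : ℂ) => theta τ (diffBar W (x + h • v) i j))
    (fun j hj => hne hj) fun j _ => (hθ i j).differentiableAt]
  refine Finset.sum_congr rfl fun j _ => ?_
  rw [logDeriv_apply, (hθ i j).deriv, logDeriv_apply, zero_smul, add_zero]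
  ring

lemma fderiv_logDelta (hτ : 0 < τ.im)
    (hx : ∀ i j : Fin n, i ≠ j → theta τ (diffBar W x i j) ≠ 0) (hl : IsLogDelta W τ l x) (v : W) :
    fderiv ℂ l x v =
      ∑ i : Fin n, ∑ j ∈ Finset.Ioi i, diffBar W v i j * logDeriv (theta τ) (diffBar W x i j) := by
  have hline := hasTwoJet_line hl.1 v
  have hexp : (fun h : ℂ => Delta W τ (x + h • v)) =ᶠ[𝓝 0] fun h => cexp (l (x + h • v)) :=
    ((tendsto_add_smul_nhds_zero x v).eventually hl.2).mono fun _ => Eq.symm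
  rw [← logDeriv_Delta_line hτ hx, logDeriv_apply, hexp.deriv_eq, hexp.eq_of_nhds,
    hline.analyticAt.differentiableAt.hasDerivAt.cexp.deriv,
    mul_div_cancel_left₀ _ (Complex.exp_ne_zero _), hline.deriv_zero]

lemma fderiv_fderiv_logDelta (hτ : 0 < τ.im)
    (hx : ∀ i j : Fin n, i ≠ j → theta τ (diffBar W x i j) ≠ 0) (hl : IsLogDelta W τ l x)
    (w v : W) :
    fderiv ℂ (fderiv ℂ l) x w v = ∑ i : Fin n, ∑ j ∈ Finset.Ioi i,
      diffBar W w i j * diffBar W v i j * deriv (logDeriv (theta τ)) (diffBar W x i j) := by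
  have hne : ∀ᶠ y in 𝓝 x, ∀ i j : Fin n, i ≠ j → theta τ (diffBar W y i j) ≠ 0 := by
    refine eventually_all.mpr fun i => eventually_all.mpr fun j => eventually_imp_distrib_left.mpr
      fun hij => ContinuousAt.eventually_ne ?_ (hx i j hij)
    simp_rw [diffBar_eq_clm]
    exact ((differentiable_theta hτ).continuous.comp (by fun_prop)).continuousAt
  have hgrad : ∀ᶠ h : ℂ in 𝓝 0, fderiv ℂ l (x + h • w) v = ∑ i : Fin n, ∑ j ∈ Finset.Ioi i,
      diffBar W v i j * logDeriv (theta τ) (diffBar W (x + h • w) i j) :=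
    (tendsto_add_smul_nhds_zero x w).eventually
      ((hne.and (eventually_isLogDelta hl)).mono fun y hy => fderiv_logDelta hτ hy.1 hy.2 v)
  have hleft : HasDerivAt (fun h : ℂ => fderiv ℂ l (x + h • w) v)
      (fderiv ℂ (fderiv ℂ l) x w v) 0 :=
    (hl.1.fderiv.differentiableAt.hasFDerivAt.hasLineDerivAt w).clm_apply (hasDerivAt_const 0 v)
      |>.congr_deriv (by simp)
  refine hleft.unique (HasDerivAt.congr_of_eventuallyEq ?_ hgrad)
  refine HasDerivAt.fun_sum fun i _ => HasDerivAt.fun_sum fun j hj => ?_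
  have hθ := (differentiable_theta hτ).analyticAt (diffBar W x i j)
  have hlog : HasDerivAt (logDeriv (theta τ)) (deriv (logDeriv (theta τ)) (diffBar W x i j))
      (diffBar W (x + (0 : ℂ) • w) i j) := by
    rw [zero_smul, add_zero]
    exact (hθ.deriv.div hθ (hx i j (Finset.mem_Ioi.mp hj).ne)).differentiableAt.hasDerivAt
  refine ((HasDerivAt.comp (h₂ := logDeriv (theta τ)) 0 hlog
    (hasDerivAt_diffBar_line x w i j)).const_mul (diffBar W v i j)).congr_deriv ?_
  ring

lemma diffBar_dir [NeZero n] (hW : weightSpace n ≤ W) (k i j : Fin n) :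
    diffBar W (dir W k) i j = (if k = i then 1 else 0) - if k = j then 1 else 0 := by
  rw [diffBar, pairBar_dir hW, pairBar_dir hW]
  ring

lemma sum_offDiag {ι R : Type*} [AddCommGroup R] (s : Finset ι) (F : ι → ι → R) :
    ∑ p ∈ s.offDiag, F p.1 p.2 = ∑ i ∈ s, ∑ j ∈ s, F i j - ∑ i ∈ s, F i i := by
  classical
  rw [← Finset.sum_product', ← Finset.diag_union_offDiag,
    Finset.sum_union (Finset.disjoint_diag_offDiag s), Finset.sum_diag, add_sub_cancel_left]

lemma sum_offDiag_diffBar_dir [NeZero n] (hW : weightSpace n ≤ W) {i j : Fin n} (hij : i ≠ j) :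
    ∑ p ∈ (Finset.univ : Finset (Fin n)).offDiag,
      diffBar W (dir W p.1) i j * diffBar W (dir W p.2) i j = -2 := by
  rw [sum_offDiag Finset.univ fun k m => diffBar W (dir W k) i j * diffBar W (dir W m) i j,
    ← Finset.sum_mul_sum]
  have hsq (k : Fin n) : diffBar W (dir W k) i j * diffBar W (dir W k) i j =
      (if k = i then 1 else 0) + if k = j then 1 else 0 := by
    rw [diffBar_dir hW]
    split_ifs with hi hj <;> simp_all
  simp_rw [hsq]
  simp only [diffBar_dir hW, Finset.sum_sub_distrib, Finset.sum_add_distrib,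
    Finset.sum_ite_eq', Finset.mem_univ, if_true]
  norm_num

lemma sum_offDiag_fderiv_fderiv_logDelta [NeZero n] (hW : weightSpace n ≤ W) (hτ : 0 < τ.im)
    (hx : ∀ i j : Fin n, i ≠ j → theta τ (diffBar W x i j) ≠ 0) (hl : IsLogDelta W τ l x) :
    ∑ p ∈ (Finset.univ : Finset (Fin n)).offDiag,
        fderiv ℂ (fderiv ℂ l) x (dir W p.1) (dir W p.2) =
      -2 * ∑ i : Fin n, ∑ j ∈ Finset.Ioi i, deriv (logDeriv (theta τ)) (diffBar W x i j) := by
  simp_rw [fderiv_fderiv_logDelta hτ hx hl]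
  rw [Finset.sum_comm, Finset.mul_sum]
  refine Finset.sum_congr rfl fun i _ => ?_
  rw [Finset.sum_comm, Finset.mul_sum]
  refine Finset.sum_congr rfl fun j hj => ?_
  rw [← Finset.sum_mul, sum_offDiag_diffBar_dir hW (Finset.mem_Ioi.mp hj).ne]

end LogDelta

/-! ### The Calogero–Moser limit -/

section CalogeroMoser

lemma sum_offDiag_pair {ι R : Type*} [DecidableEq ι] [AddCommMonoid R] (s : Finset ι)
    (F : Finset ι → R) :
    ∑ p ∈ s.offDiag, F {p.1, p.2} = 2 • ∑ K ∈ Finset.powersetCard 2 s, F K := by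
  have hmaps (p : ι × ι) (hp : p ∈ s.offDiag) : {p.1, p.2} ∈ Finset.powersetCard 2 s := by
    obtain ⟨h₁, h₂, hne⟩ := Finset.mem_offDiag.mp hp
    exact Finset.mem_powersetCard.mpr ⟨by simp [Finset.insert_subset_iff, h₁, h₂],
      Finset.card_pair hne⟩
  rw [← Finset.sum_fiberwise_of_maps_to' hmaps, Finset.smul_sum]
  refine Finset.sum_congr rfl fun K hK => ?_
  obtain ⟨hKs, hcard⟩ := Finset.mem_powersetCard.mp hK
  obtain ⟨a, b, hab, rfl⟩ := Finset.card_eq_two.mp hcard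
  have hfiber : {p ∈ s.offDiag | ({p.1, p.2} : Finset ι) = {a, b}} = {(a, b), (b, a)} := by
    ext ⟨i, j⟩
    have := hKs (Finset.mem_insert_self a {b})
    have := hKs (Finset.mem_insert_of_mem (Finset.mem_singleton_self b))
    simp only [Finset.mem_filter, Finset.mem_offDiag, Finset.mem_insert, Finset.mem_singleton,
      Prod.mk.injEq, ← Finset.coe_inj, Finset.coe_pair, Set.pair_eq_pair_iff]
    grind
  rw [Finset.sum_const, hfiber, Finset.card_pair (by simp [hab])]

section Normed

variable {E : Type*} [NormedAddCommGroup E] [NormedSpace ℂ E] {l f : E → ℂ} {p : E}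

/-- `(∂_v - g ∂_v l)² f` at `p`, which is the conjugate `e^{g l} ∘ ∂_v² ∘ e^{-g l}` of the second
derivative, in expanded form. -/
def conjSecondDeriv (l f : E → ℂ) (p : E) (g : ℂ) (v : E) : ℂ :=
  fderiv ℂ (fderiv ℂ f) p v v - 2 * g * fderiv ℂ l p v * fderiv ℂ f p v +
    (g ^ 2 * fderiv ℂ l p v ^ 2 - g * fderiv ℂ (fderiv ℂ l) p v v) * f p

lemma deriv_deriv_exp_mul_line (hl : AnalyticAt ℂ l p) (hf : AnalyticAt ℂ f p) (g : ℂ) (v : E) :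
    deriv (deriv fun h : ℂ => cexp (-g * l (p + h • v)) * f (p + h • v)) 0 =
      cexp (-g * l p) * conjSecondDeriv l f p g v := by
  rw [(((hasTwoJet_line hl v).const_mul (-g)).exp.mul (hasTwoJet_line hf v)).deriv_deriv_zero,
    conjSecondDeriv]
  ring

lemma hasTwoJet_diag (hl : AnalyticAt ℂ l p) (hf : AnalyticAt ℂ f p) (g : ℂ) (v : E) :
    HasTwoJet (fun h => cexp (logRatio l p g 0 v h + logRatio l p g v v h) * f (p + h • (v + v)) -
      2 * (cexp (logRatio l p g 0 v h) * f (p + h • v)) + f p) 0 0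
      (2 * conjSecondDeriv l f p g v) := by
  have htwice := ((hasTwoJet_logRatio hl g 0 v).add (hasTwoJet_logRatio hl g v v)).of_eq
    (add_zero 0) rfl rfl
  refine (((htwice.exp_mul_line hf (v + v)).sub
    (((hasTwoJet_logRatio hl g 0 v).exp_mul_line hf v).const_mul 2)).add
      (HasTwoJet.const (f p))).of_eq (by ring) (by simp only [map_add]; ring) ?_
  simp only [map_add, map_zero, add_apply, conjSecondDeriv]
  ring

lemma hasTwoJet_offDiag (hl : AnalyticAt ℂ l p) (hf : AnalyticAt ℂ f p) (g : ℂ) (v w : E) :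
    HasTwoJet (fun h => cexp (logRatio l p g 0 v h + logRatio l p g v w h) * f (p + h • (v + w)) -
      cexp (logRatio l p g 0 (v + w) h) * f (p + h • (v + w))) 0 0
      (-2 * g * (g + 1) * f p * fderiv ℂ (fderiv ℂ l) p v w) := by
  have htwice := ((hasTwoJet_logRatio hl g 0 v).add (hasTwoJet_logRatio hl g v w)).of_eq
    (add_zero 0) rfl rfl
  refine ((htwice.exp_mul_line hf (v + w)).sub
    ((hasTwoJet_logRatio hl g 0 (v + w)).exp_mul_line hf (v + w))).of_eq (by ring)
      (by simp only [map_add]; ring) ?_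
  simp only [map_add, map_zero, add_apply, fderiv_fderiv_comm hl w v]
  ring

end Normed

variable {n : ℕ} {W : Submodule ℂ (EuclideanSpace ℂ (Fin n))} {τ c u : ℂ} {x : W} {l f : W → ℂ}

lemma eventually_Mdot_eq_sum_exp [NeZero n] (hW : weightSpace n ≤ W) (hτ : 0 < τ.im) (c : ℂ)
    (hu : theta τ u ≠ 0) (hl : IsLogDelta W τ l x) (w : W) (d : ℕ) :
    ∀ᶠ h in 𝓝 0, ∀ f : W → ℂ, Mdot W τ c h u d f (x + h • w) =
      ∑ K ∈ Finset.powersetCard d (Finset.univ : Finset (Fin n)),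
        cexp (logRatio l x (c / n) w (∑ i ∈ K, dir W i) h) *
          f (x + h • (w + ∑ i ∈ K, dir W i)) := by
  have hx : Delta W τ x ≠ 0 := hl.2.self_of_nhds ▸ Complex.exp_ne_zero _
  have hexp (v : W) : ∀ᶠ h : ℂ in 𝓝 0, cexp (l (x + h • v)) = Delta W τ (x + h • v) :=
    (tendsto_add_smul_nhds_zero x v).eventually hl.2
  filter_upwards [eventually_Mdot_eq_sum hW hτ c hu hx (y := fun h => x + h • w) (by fun_prop)
    (by simp) d, hexp w, (Finset.eventually_all (Finset.powersetCard d Finset.univ)).mpr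
      fun K _ => hexp (w - (c / n) • ∑ i ∈ K, dir W i)] with h hM hw hK f
  rw [hM]
  refine Finset.sum_congr rfl fun K hKd => ?_
  rw [logRatio, Complex.exp_sub, hK K hKd, hw, smul_add, add_assoc, smul_sub, smul_smul,
    mul_comm h, add_sub_assoc]

lemma eventually_Mdot_one_eq_sum_exp [NeZero n] (hW : weightSpace n ≤ W) (hτ : 0 < τ.im) (c : ℂ)
    (hu : theta τ u ≠ 0) (hl : IsLogDelta W τ l x) (w : W) :
    ∀ᶠ h in 𝓝 0, ∀ f : W → ℂ, Mdot W τ c h u 1 f (x + h • w) =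
      ∑ i, cexp (logRatio l x (c / n) w (dir W i) h) * f (x + h • (w + dir W i)) := by
  filter_upwards [eventually_Mdot_eq_sum_exp hW hτ c hu hl w 1] with h hM f
  simp [hM, Finset.powersetCard_one]

lemma eventually_two_mul_Mdot_two_eq_sum_exp [NeZero n] (hW : weightSpace n ≤ W) (hτ : 0 < τ.im)
    (c : ℂ) (hu : theta τ u ≠ 0) (hl : IsLogDelta W τ l x) :
    ∀ᶠ h in 𝓝 0, ∀ f : W → ℂ, 2 * Mdot W τ c h u 2 f x =
      ∑ p ∈ (Finset.univ : Finset (Fin n)).offDiag,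
        cexp (logRatio l x (c / n) 0 (dir W p.1 + dir W p.2) h) *
          f (x + h • (dir W p.1 + dir W p.2)) := by
  filter_upwards [eventually_Mdot_eq_sum_exp hW hτ c hu hl 0 2] with h hM f
  have hM := hM f
  rw [smul_zero, add_zero] at hM
  rw [hM, ← Nat.cast_ofNat, ← nsmul_eq_mul, ← sum_offDiag_pair]
  refine Finset.sum_congr rfl fun p hp => ?_
  rw [Finset.sum_pair (Finset.mem_offDiag.mp hp).2.2, zero_add]

lemma eventually_Mdot_one_Mdot_one_eq_sum_exp [NeZero n] (hW : weightSpace n ≤ W)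
    (hτ : 0 < τ.im) (c : ℂ) (hu : theta τ u ≠ 0) (hl : IsLogDelta W τ l x) :
    ∀ᶠ h in 𝓝 0, ∀ f : W → ℂ, Mdot W τ c h u 1 (Mdot W τ c h u 1 f) x =
      ∑ i, ∑ j, cexp (logRatio l x (c / n) 0 (dir W i) h +
        logRatio l x (c / n) (dir W i) (dir W j) h) * f (x + h • (dir W i + dir W j)) := by
  filter_upwards [eventually_Mdot_one_eq_sum_exp hW hτ c hu hl 0,
    eventually_all.mpr fun i => eventually_Mdot_one_eq_sum_exp hW hτ c hu hl (dir W i)]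
    with h hfirst hsecond f
  have hfirst := hfirst (Mdot W τ c h u 1 f)
  rw [smul_zero, add_zero] at hfirst
  rw [hfirst]
  refine Finset.sum_congr rfl fun i _ => ?_
  rw [zero_add, hsecond, Finset.mul_sum]
  exact Finset.sum_congr rfl fun j _ => by rw [Complex.exp_add, mul_assoc]

lemma eventually_Mdot_combination_eq [NeZero n] (hW : weightSpace n ≤ W) (hτ : 0 < τ.im) (c : ℂ)
    (hu : theta τ u ≠ 0) (hl : IsLogDelta W τ l x) (f : W → ℂ) :
    ∀ᶠ h in 𝓝 0, -2 * Mdot W τ c h u 2 f x + Mdot W τ c h u 1 (Mdot W τ c h u 1 f) x -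
        2 * Mdot W τ c h u 1 f x + n * f x =
      ∑ i, (cexp (logRatio l x (c / n) 0 (dir W i) h +
          logRatio l x (c / n) (dir W i) (dir W i) h) * f (x + h • (dir W i + dir W i)) -
        2 * (cexp (logRatio l x (c / n) 0 (dir W i) h) * f (x + h • dir W i)) + f x) +
      ∑ p ∈ (Finset.univ : Finset (Fin n)).offDiag,
        (cexp (logRatio l x (c / n) 0 (dir W p.1) h +
          logRatio l x (c / n) (dir W p.1) (dir W p.2) h) * f (x + h • (dir W p.1 + dir W p.2)) -
        cexp (logRatio l x (c / n) 0 (dir W p.1 + dir W p.2) h) *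
          f (x + h • (dir W p.1 + dir W p.2))) := by
  filter_upwards [eventually_Mdot_one_eq_sum_exp hW hτ c hu hl 0,
    eventually_two_mul_Mdot_two_eq_sum_exp hW hτ c hu hl,
    eventually_Mdot_one_Mdot_one_eq_sum_exp hW hτ c hu hl] with h hone htwo hsq
  have hone := hone f
  simp only [smul_zero, add_zero, zero_add] at hone
  rw [neg_mul, htwo, hsq, hone, Finset.sum_add_distrib, Finset.sum_sub_distrib,
    Finset.sum_sub_distrib, sum_offDiag Finset.univ fun i j =>
      cexp (logRatio l x (c / n) 0 (dir W i) h + logRatio l x (c / n) (dir W i) (dir W j) h) *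
        f (x + h • (dir W i + dir W j)), ← Finset.mul_sum, Finset.sum_const, Finset.card_univ,
    Fintype.card_fin, nsmul_eq_mul]
  ring

lemma pd_pd_eq_deriv_deriv (i : Fin n) (F : W → ℂ) (x : W) :
    pd W i (pd W i F) x = deriv (deriv fun h : ℂ => F (x + h • dir W i)) 0 := by
  have hderiv (t : ℂ) :
      pd W i F (x + t • dir W i) = deriv (fun h : ℂ => F (x + h • dir W i)) t := by
    have hshift := deriv_comp_const_add (f := fun h : ℂ => F (x + h • dir W i)) t 0
    rw [add_zero] at hshift
    simp_rw [pd, lineDeriv, ← hshift, add_smul, add_assoc]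
  exact congrArg (deriv · 0) (funext hderiv)

lemma Hop_eq (hl : AnalyticAt ℂ l x) (hf : AnalyticAt ℂ f x) :
    Hop W τ c l f x = ∑ i, conjSecondDeriv l f x (c / n) (dir W i) +
      2 * (c / n) * (c / n + 1) *
        (∑ i : Fin n, ∑ j ∈ Finset.Ioi i, deriv (logDeriv (theta τ)) (diffBar W x i j)) * f x := by
  have hexp : cexp (c / n * l x) * cexp (-(c / n) * l x) = 1 := by
    rw [← Complex.exp_add, neg_mul, add_neg_cancel, Complex.exp_zero]
  simp only [Hop, pd_pd_eq_deriv_deriv, deriv_deriv_exp_mul_line hl hf, ← Finset.mul_sum]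
  linear_combination (∑ i, conjSecondDeriv l f x (c / n) (dir W i) +
    2 * (c / n) * (c / n + 1) * (∑ i : Fin n, ∑ j ∈ Finset.Ioi i,
      deriv (logDeriv (theta τ)) (diffBar W x i j)) * f x) * hexp

theorem tendsto_calogeroMoser [NeZero n] (hW : weightSpace n ≤ W) (hτ : 0 < τ.im) (c : ℂ)
    (hu : theta τ u ≠ 0) (hx : ∀ i j : Fin n, i ≠ j → theta τ (diffBar W x i j) ≠ 0)
    (hf : AnalyticAt ℂ f x) (hl : IsLogDelta W τ l x) :
    Tendsto (fun h : ℂ =>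
        (-2 * Mdot W τ c h u 2 f x + Mdot W τ c h u 1 (Mdot W τ c h u 1 f) x -
          2 * Mdot W τ c h u 1 f x + n * f x) / h ^ 2)
      (𝓝[≠] 0) (𝓝 (Hop W τ c l f x)) := by
  have hdiag := HasTwoJet.sum Finset.univ fun i _ => hasTwoJet_diag hl.1 hf (c / n) (dir W i)
  have hoffDiag := HasTwoJet.sum (Finset.univ : Finset (Fin n)).offDiag fun p _ =>
    hasTwoJet_offDiag hl.1 hf (c / n) (dir W p.1) (dir W p.2)
  have hjet := ((hdiag.add hoffDiag).congr
    (eventually_Mdot_combination_eq hW hτ c hu hl f)).of_eq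
    (a' := 0) (b' := 0) (by simp) (by simp) rfl
  convert hjet.tendsto_div_sq using 2
  rw [Hop_eq hl.1 hf, ← Finset.mul_sum, ← Finset.mul_sum,
    sum_offDiag_fderiv_fderiv_logDelta hW hτ hx hl]
  ring

end CalogeroMoser

end EllipticCM

end

theorem proposition5 (n : ℕ) (hn : 1 < n)
    (W : Submodule ℂ (EuclideanSpace ℂ (Fin n)))
    (hW : W = EllipticCM.weightSpace n ∨ W = ⊤)
    (τ : ℂ) (hτ : 0 < τ.im) (c u : ℂ) (hu : EllipticCM.theta τ u ≠ 0)
    (x : W) (hx : ∀ i j : Fin n, i ≠ j → EllipticCM.theta τ (EllipticCM.diffBar W x i j) ≠ 0)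
    (f : W → ℂ) (hf : AnalyticAt ℂ f x) :
    (∀ k' ≤ n, AnalyticAt ℂ (fun h : ℂ => EllipticCM.Mdot W τ c h u k' f x) 0) ∧
    (c ≠ 0 → ∀ d k : ℕ, k ≤ d → d ≤ n →
      EllipticCM.Dop W τ c (d - k) f x =
        (-(n / c)) ^ d / ((n - d + k).choose k : ℂ) *
          ∑ k' ∈ Finset.range (d + 1),
            (-1) ^ (d - k') * ((n - k').choose (n - d) : ℂ) *
              ((-(c * k' / n)) ^ k / (k.factorial : ℂ)) *
              (iteratedDeriv (d - k) (fun h : ℂ => EllipticCM.Mdot W τ c h u k' f x) 0 /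
                ((d - k).factorial : ℂ))) ∧
    (∃ l : W → ℂ, EllipticCM.IsLogDelta W τ l x) ∧
    (∀ l : W → ℂ, EllipticCM.IsLogDelta W τ l x →
      Tendsto (fun h : ℂ =>
          (-2 * EllipticCM.Mdot W τ c h u 2 f x
            + EllipticCM.Mdot W τ c h u 1 (EllipticCM.Mdot W τ c h u 1 f) x
            - 2 * EllipticCM.Mdot W τ c h u 1 f x + n * f x) / h ^ 2)
        (𝓝[≠] 0) (𝓝 (EllipticCM.Hop W τ c l f x))) := by
  have : NeZero n := ⟨by omega⟩
  have hW' : EllipticCM.weightSpace n ≤ W := hW.elim (·.ge) (· ▸ le_top)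
  have hΔ := EllipticCM.Delta_ne_zero hx
  exact ⟨fun k' _ => EllipticCM.analyticAt_Mdot hW' hτ c hu hΔ hf k',
    fun hc _ _ hk hd => EllipticCM.Dop_eq_sum_iteratedDeriv hW' hτ hc hu hΔ hf hk hd,
    EllipticCM.exists_isLogDelta hτ hΔ,
    fun _ hl => EllipticCM.tendsto_calogeroMoser hW' hτ c hu hx hf hl⟩
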